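/- **Setting.** Let $p$ be a fixed dimension, $\beta^*\in\mathbb R^p$, and let $(X,Z,\epsilon)$ take values in $\mathbb R\times\mathbb R^p\times\mathbb R$. Put $\zeta:=X+Z^\top\beta^*$ and $Y:=\mathrm{sign}(\zeta+\epsilon)\in\{-1,+1\}$ (with $\mathrm{sign}(0)=+1$), and suppose that $\mathrm{median}(\epsilon\mid X,Z)=0$. Assume the following, where $\alpha\ge 2$ is an integer. 1. $H:\mathbb R\to\mathbb R$ is twice differentiable, $H''$ is bounded and Lipschitz continuous, $H(x)=1$ for $x>1$, $H(x)=0$ for $x<-1$, $\int_{-1}^1 H'(x)^2\,dx<\infty$, $\int_{-1}^1x^kH'(x)\,dx=0$ for $k=1,\dots,\alpha-1$, and $\int_{-1}^1x^\alpha H'(x)\,dx\neq0$. 2. Given $Z$, the variable $\zeta$ has a density $\rho(\cdot\mid Z)$ that is positive and bounded for almost every $Z$; within a neighbourhood of $0$ its derivatives of the orders $1,\dots,\alpha$ exist and are bounded, with neighbourhood and bound common to almost every $Z$. 3. $\epsilon$ and $X$ are independent given $Z$; within a neighbourhood of $0$ the derivatives of the orders $1,\dots,\alpha+1$ of the conditional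 distribution function $F(\cdot\mid Z)$ of $\epsilon$ given $Z$ exist and are bounded, with neighbourhood and bound common to almost every $Z$. 4. For some constant $c_1>0$, all eigenvalues of $V:=2\,\mathbb E[\rho(0\mid Z)F'(0\mid Z)ZZ^\top]$ lie strictly between $c_1^{-1}$ and $c_1$. 5. There is $\overline B$ with $\|Z\|_\infty\le\overline B$ almost surely. Let $n=Lm\to\infty$ (with no restriction on how $L$ and $m$ vary), and let $n$ i.i.d. copies $(x_i,z_i,\epsilon_i)$ of $(X,Z,\epsilon)$, with responses $y_i=\mathrm{sign}(x_i+z_i^\top\beta^*+\epsilon_i)$, be split over $L$ machines $\mathcal H_1,\dots,\mathcal H_L$ with $m$ data points each. Let $h_1>0$ be a bandwidth and let $\widehat\beta^{(0)}$ be any random vector (the initial estimator). Machine $\ell$ computes $$U_{m,\ell}=\frac1{mh_1}\sum_{i\in\mathcal H_\ell}(-y_i)H'\Big(\frac{x_i+z_i^\top\widehat\beta^{(0)}}{h_1}\Big)z_i,\qquad V_{m,\ell}=\frac1{mh_1^2}\sum_{i\in\mathcal H_\ell}(-y_i)H''\Big(\frac{x_i+z_i^\top\widehat\beta^{(0)}}{h_1}\Big)z_iz_i^\top,$$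 and with $U_n=\frac1L\sum_\ell U_{m,\ell}$, $V_n=\frac1L\sum_\ell V_{m,\ell}$ the one-step estimator is $\widehat\beta^{(1)}=\widehat\beta^{(0)}-V_n^{-1}U_n$. **Proposition 1.** Suppose in addition that $\|\widehat\beta^{(0)}-\beta^*\|_2=O_{\mathbb P}(\delta)$ for a positive deterministic sequence $\delta$ with $\delta=O(h_1)$, that $h_1\to0$, and that $\frac{\log n}{nh_1^3}\to0$. Then $V_n$ is invertible with probability tending to one, so that $\widehat\beta^{(1)}$ is well defined with probability tending to one, and $$\big\|\widehat\beta^{(1)}-\beta^*\big\|_2=O_{\mathbb P}\bigg(\delta^2+h_1^\alpha+\sqrt{\frac1{nh_1}}+\delta\sqrt{\frac{\log n}{nh_1^3}}\bigg).$$ -/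

import Mathlib

open MeasureTheory ProbabilityTheory Filter Topology Asymptotics

noncomputable section

namespace SMSE

/-- `ℝ^p` with the Euclidean norm. -/
abbrev Vec (p : ℕ) : Type := EuclideanSpace ℝ (Fin p)

/-- The type of the triples `(X, Z, ε)` of the binary response model. -/
abbrev Triple (p : ℕ) : Type := ℝ × Vec p × ℝ

section Model

variable {p : ℕ}

/-- The scalar covariate `X`. -/
def covX (w : Triple p) : ℝ := w.1

/-- The vector covariate `Z`. -/
def covZ (w : Triple p) : Vec p := w.2.1

/-- The noise `ε`. -/
def noise (w : Triple p) : ℝ := w.2.2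

/-- The index `ζ = X + Zᵀ β*`. -/
def zeta (βs : Vec p) (w : Triple p) : ℝ := covX w + inner ℝ (covZ w) βs

/-- The response `Y = sign (X + Zᵀ β* + ε) ∈ {-1, +1}`, with `sign 0 = +1`. -/
def response (βs : Vec p) (w : Triple p) : ℝ :=
  if 0 ≤ zeta βs w + noise w then 1 else -1

/-- What is observed of a triple: `(Y, X, Z)`. -/
def observe (βs : Vec p) (w : Triple p) : ℝ × ℝ × Vec p := (response βs w, covX w, covZ w)

theorem measurable_covX : Measurable (covX (p := p)) := measurable_fst

theorem measurable_covZ : Measurable (covZ (p := p)) := measurable_fst.comp measurable_snd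

theorem measurable_noise : Measurable (noise (p := p)) := measurable_snd.comp measurable_snd

end Model

section Estimator

variable {p : ℕ}

/-- The gradient at `β` of the smoothed objective `(1/m) ∑ᵢ (-yᵢ) H((xᵢ + zᵢᵀ β)/h)` of one
machine that holds the `m` observations `(yᵢ, xᵢ, zᵢ)`. -/
def localGrad (H : ℝ → ℝ) (h : ℝ) {m : ℕ} (D : Fin m → ℝ × ℝ × Vec p) (β : Vec p) : Vec p :=
  (1 / (m * h)) • ∑ i, (-(D i).1 * deriv H (((D i).2.1 + inner ℝ (D i).2.2 β) / h)) • (D i).2.2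

/-- The Hessian at `β` of the smoothed objective of one machine. -/
def localHess (H : ℝ → ℝ) (h : ℝ) {m : ℕ} (D : Fin m → ℝ × ℝ × Vec p) (β : Vec p) :
    Matrix (Fin p) (Fin p) ℝ :=
  (1 / (m * h ^ 2)) • ∑ i,
    (-(D i).1 * deriv (deriv H) (((D i).2.1 + inner ℝ (D i).2.2 β) / h)) •
      Matrix.vecMulVec (D i).2.2.ofLp (D i).2.2.ofLp

/-- The average over the `L` machines of the local gradients. -/
def avgGrad (H : ℝ → ℝ) (h : ℝ) {L m : ℕ} (D : Fin L → Fin m → ℝ × ℝ × Vec p) (β : Vec p) :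
    Vec p :=
  (1 / (L : ℝ)) • ∑ l, localGrad H h (D l) β

/-- The average over the `L` machines of the local Hessians. -/
def avgHess (H : ℝ → ℝ) (h : ℝ) {L m : ℕ} (D : Fin L → Fin m → ℝ × ℝ × Vec p) (β : Vec p) :
    Matrix (Fin p) (Fin p) ℝ :=
  (1 / (L : ℝ)) • ∑ l, localHess H h (D l) β

/-- One distributed Newton step from `β` with bandwidth `h`: the central machine averages the local
gradients and Hessians and updates `β` to `β - (Hessian)⁻¹ (gradient)`. -/
def newtonStep (H : ℝ → ℝ) (h : ℝ) {L m : ℕ} (D : Fin L → Fin m → ℝ × ℝ × Vec p) (β : Vec p) :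
    Vec p :=
  β - WithLp.toLp 2 (Matrix.mulVec (avgHess H h D β)⁻¹ (avgGrad H h D β).ofLp)

end Estimator

/-- `X k = O_ℙ(a k)` as `k → ∞`: for every `ε > 0` there is `M` with
`ℙ(|X k| > M a k) ≤ ε` for all large `k`. -/
def IsBigOP {Ω : Type*} [MeasurableSpace Ω] (μ : Measure Ω) (X : ℕ → Ω → ℝ) (a : ℕ → ℝ) : Prop :=
  ∀ ε : ℝ, 0 < ε → ∃ M : ℝ, ∀ᶠ k in atTop, μ {ω | M * a k < |X k ω|} ≤ ENNReal.ofReal ε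

/-- On `(-η, η)` the derivatives of `g` of the orders `1, …, N` exist and are bounded by `M`. -/
def BoundedDerivsNearZero (g : ℝ → ℝ) (N : ℕ) (η M : ℝ) : Prop :=
  ∀ k < N, ∀ t ∈ Set.Ioo (-η) η,
    DifferentiableAt ℝ (iteratedDeriv k g) t ∧ |iteratedDeriv (k + 1) g t| ≤ M

/-- `H` is the integral of a kernel `H'` of order `α ≥ 2` which is supported in `[-1, 1]` and has a
bounded and Lipschitz continuous derivative `H''`. -/
structure IsSmoother (H : ℝ → ℝ) (α : ℕ) : Prop where
  two_le : 2 ≤ α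
  differentiable : Differentiable ℝ H
  differentiable_deriv : Differentiable ℝ (deriv H)
  moment_ne_zero : ∫ x in (-1 : ℝ)..1, x ^ α * deriv H x ≠ 0
  moment_eq_zero : ∀ k : ℕ, 1 ≤ k → k < α → ∫ x in (-1 : ℝ)..1, x ^ k * deriv H x = 0
  sq_integrable : IntervalIntegrable (fun x => deriv H x ^ 2) volume (-1) 1
  bounded : ∃ C : ℝ, ∀ x, |deriv (deriv H) x| ≤ C
  lipschitz : ∃ K : NNReal, LipschitzWith K (deriv (deriv H))
  eq_one : ∀ x, 1 < x → H x = 1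
  eq_zero : ∀ x, x < -1 → H x = 0

section Population

variable {p : ℕ}

/-- `0` is a median of `ε` conditionally on `(X, Z)`; `P` is the law of `(X, Z, ε)`. -/
def NoiseMedianZero (P : Measure (Triple p)) [IsFiniteMeasure P] : Prop :=
  ∀ᵐ v ∂(P.map fun w => (covX w, covZ w)),
    1 / 2 ≤ (condDistrib noise (fun w => (covX w, covZ w)) P v).real (Set.Iic 0) ∧
    1 / 2 ≤ (condDistrib noise (fun w => (covX w, covZ w)) P v).real (Set.Ici 0)

/-- `ρ(· | z)` is a conditional Lebesgue density of `ζ = X + Zᵀ β*` given `Z = z`. -/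
structure IsCondDensity (P : Measure (Triple p)) [IsFiniteMeasure P] (βs : Vec p)
    (ρ : Vec p → ℝ → ℝ) : Prop where
  measurable : Measurable (Function.uncurry ρ)
  condDistrib_eq : ∀ᵐ z ∂(P.map covZ),
    condDistrib (zeta βs) covZ P z = volume.withDensity fun t => ENNReal.ofReal (ρ z t)

/-- The conditional density `ρ(· | Z)` of `ζ` is positive and bounded for almost every `Z`, and
within a neighbourhood of `0` its derivatives up to the order `α` exist and are bounded, uniformly
for almost every `Z`. -/
structure IndexDensityRegular (P : Measure (Triple p)) (ρ : Vec p → ℝ → ℝ) (α : ℕ) : Prop where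
  pos : ∀ᵐ z ∂(P.map covZ), ∀ t, 0 < ρ z t
  bounded : ∀ᵐ z ∂(P.map covZ), ∃ B : ℝ, ∀ t, ρ z t ≤ B
  derivs : ∃ η > 0, ∃ M : ℝ, ∀ᵐ z ∂(P.map covZ), BoundedDerivsNearZero (ρ z) α η M

/-- `F(t | z) = ℙ(ε ≤ t | Z = z)`, the conditional distribution function of the noise. -/
def noiseCDF (P : Measure (Triple p)) [IsFiniteMeasure P] (z : Vec p) (t : ℝ) : ℝ :=
  (condDistrib noise covZ P z).real (Set.Iic t)

/-- `ε` and `X` are independent given `Z`, and within a neighbourhood of `0` the derivatives of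
`F(· | Z)` up to the order `α + 1` exist and are bounded, uniformly for almost every `Z`. -/
structure NoiseRegular (P : Measure (Triple p)) [IsFiniteMeasure P] (α : ℕ) : Prop where
  condIndep : CondIndepFun (MeasurableSpace.comap covZ inferInstance) measurable_covZ.comap_le
    noise covX P
  derivs : ∃ η > 0, ∃ M : ℝ, ∀ᵐ z ∂(P.map covZ), BoundedDerivsNearZero (noiseCDF P z) (α + 1) η M

/-- The population Hessian `V = 2 𝔼[ρ(0 | Z) F'(0 | Z) Z Zᵀ]`. -/
def popHess (P : Measure (Triple p)) [IsFiniteMeasure P] (ρ : Vec p → ℝ → ℝ) :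
    Matrix (Fin p) (Fin p) ℝ :=
  Matrix.of fun a b =>
    2 * ∫ w, ρ (covZ w) 0 * deriv (noiseCDF P (covZ w)) 0 * (covZ w a * covZ w b) ∂P

/-- All eigenvalues of the (symmetric) matrix `V` lie strictly between `c⁻¹` and `c`, for some
constant `c > 0`. -/
def PopHessNondegenerate (P : Measure (Triple p)) [IsFiniteMeasure P] (ρ : Vec p → ℝ → ℝ) : Prop :=
  ∃ c > 0, ∀ r ∈ spectrum ℝ (popHess P ρ), c⁻¹ < r ∧ r < c

/-- The vector covariate is bounded: `‖Z‖_∞ ≤ B` almost surely. -/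
def CovariatesBounded (P : Measure (Triple p)) : Prop :=
  ∃ B : ℝ, ∀ᵐ w ∂P, ∀ a, |covZ w a| ≤ B

end Population

end SMSE

end

/-! Write the initial estimator as `β* + δ u`. With probability close to one `‖u‖ ≤ M`, so
everything is shown uniformly over this cube, and the dependence of the initial estimator on the
sample does no harm. If `Q` is the averaged Hessian and `U` the averaged gradient there, the error
of the Newton step is `Q⁻¹ (Q (δ u) - U)` (`newtonStep_sub`). It remains to show that `Q` is close
to the invertible `V` and that `Q (δ u) - U` has the asserted size. Both are empirical means over
all `n` observations (`hessTerm`, `newtonTerm`), so the division into machines plays no role.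

Means. Given `Z = z`, the mean of `-Y` at `ζ = t`, weighted by the density, is the drift `g t = (2
F(-t) - 1) ρ t`. It has `α` bounded derivatives near `0`, the median condition gives `g 0 = 0`, and
`g' 0 = -2 ρ(0) F'(0)`. After the substitution `ζ = h s - a`, `a = δ zᵀu`, an integration by parts
turns `H''` into `H'`. The mean Hessian is then `V` up to `O(h + δ)`. In the mean of `Q (δ u) - U`
the part linear in `a` cancels, which leaves a Taylor remainder `O(δ²)` and the kernel bias `O(h^α)`
from the vanishing moments of `H'`.

Fluctuations. At `u = 0` the second moment of `newtonTerm` is `O(1/h)`, and Chebyshev's inequality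
gives `(n h)^(-1/2)`. The increments of `newtonTerm` from `u = 0`, divided by `δ`, and `hessTerm`
form classes with envelope of order `h⁻²`, second moments of order `h⁻³` and Lipschitz constant of
order `h⁻³`. A Bernstein bound on a grid with `(2 n + 1)^p` points (`measure_exists_lt_empDev_le`)
bounds both uniformly by a multiple of `√(log n / (n h³))`. This is the last term of the rate, and
it makes `Q` close to its mean. -/

namespace SMSE

set_option linter.unusedSectionVars false

/-- On `(-η, η)` the function `f` and its successive derivatives of the orders `1, …, N` exist and
are bounded by `C`. -/
def DerivsBdd (η C : ℝ) : ℕ → (ℝ → ℝ) → Prop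
  | 0, f => ∀ t ∈ Set.Ioo (-η) η, |f t| ≤ C
  | N + 1, f => (∀ t ∈ Set.Ioo (-η) η, |f t| ≤ C) ∧
      ∃ f' : ℝ → ℝ, (∀ t ∈ Set.Ioo (-η) η, HasDerivAt f (f' t) t) ∧ DerivsBdd η C N f'

/-! ### Functions with bounded derivatives near zero and their Taylor expansion -/

namespace DerivsBdd

variable {η C C₁ C₂ : ℝ} {N : ℕ} {f g : ℝ → ℝ}

theorem bound (hf : DerivsBdd η C N f) : ∀ t ∈ Set.Ioo (-η) η, |f t| ≤ C := by
  cases N with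
  | zero => exact hf
  | succ N => exact hf.1

theorem mono (hC : C₁ ≤ C₂) (hf : DerivsBdd η C₁ N f) : DerivsBdd η C₂ N f := by
  induction N generalizing f with
  | zero => exact fun t ht => (hf t ht).trans hC
  | succ N ih =>
    obtain ⟨h₀, f', hf', h₁⟩ := hf
    exact ⟨fun t ht => (h₀ t ht).trans hC, f', hf', ih h₁⟩

theorem pred (hf : DerivsBdd η C (N + 1) f) : DerivsBdd η C N f := by
  induction N generalizing f with
  | zero => exact hf.1
  | succ N ih =>
    obtain ⟨h₀, f', hf', h₁⟩ := hf
    exact ⟨h₀, f', hf', ih h₁⟩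

theorem of_le {M : ℕ} (hM : M ≤ N) (hf : DerivsBdd η C N f) : DerivsBdd η C M f := by
  induction N, hM using Nat.le_induction with
  | base => exact hf
  | succ N _ ih => exact ih hf.pred

theorem const (c : ℝ) : DerivsBdd η |c| N fun _ => c := by
  suffices h : ∀ c d : ℝ, |c| ≤ |d| → DerivsBdd η |d| N fun _ => c from h c c le_rfl
  induction N with
  | zero => exact fun c d h _ _ => h
  | succ N ih =>
    -- The derivative `0` has to keep the bound `|d|`, hence the statement with two constants.
    exact fun c d h => ⟨fun _ _ => h, fun _ => 0, fun t _ => hasDerivAt_const t c,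
      ih 0 d (by simp)⟩

theorem add (hf : DerivsBdd η C₁ N f) (hg : DerivsBdd η C₂ N g) :
    DerivsBdd η (C₁ + C₂) N fun t => f t + g t := by
  induction N generalizing f g with
  | zero => exact fun t ht => (abs_add_le _ _).trans (add_le_add (hf t ht) (hg t ht))
  | succ N ih =>
    obtain ⟨h₀, f', hf', h₁⟩ := hf
    obtain ⟨k₀, g', hg', k₁⟩ := hg
    exact ⟨fun t ht => (abs_add_le _ _).trans (add_le_add (h₀ t ht) (k₀ t ht)),
      fun t => f' t + g' t, fun t ht => (hf' t ht).add (hg' t ht), ih h₁ k₁⟩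

/-- The product rule expresses the derivative as a sum of two products with one order of smoothness
less. Each differentiation thus doubles the constant, whence `2 ^ N`. -/
theorem mul (hC₁ : 0 ≤ C₁) (hC₂ : 0 ≤ C₂) (hf : DerivsBdd η C₁ N f) (hg : DerivsBdd η C₂ N g) :
    DerivsBdd η (2 ^ N * (C₁ * C₂)) N fun t => f t * g t := by
  have key : ∀ t, |f t| ≤ C₁ → |g t| ≤ C₂ → |f t * g t| ≤ C₁ * C₂ := fun t h k => by
    rw [abs_mul]; exact mul_le_mul h k (abs_nonneg _) hC₁
  induction N generalizing f g with
  | zero => exact fun t ht => by simpa using key t (hf t ht) (hg t ht)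
  | succ N ih =>
    have hf₀ := hf
    have hg₀ := hg
    obtain ⟨h₀, f', hf', h₁⟩ := hf
    obtain ⟨k₀, g', hg', k₁⟩ := hg
    have hfg : DerivsBdd η (2 ^ N * (C₁ * C₂) + 2 ^ N * (C₁ * C₂)) N
        fun t => f' t * g t + f t * g' t := by
      refine (ih h₁ hg₀.pred ?_).add (ih hf₀.pred k₁ ?_) <;>
      · intro t h k
        rw [abs_mul]
        exact mul_le_mul h k (abs_nonneg _) hC₁
    refine ⟨fun t ht => (key t (h₀ t ht) (k₀ t ht)).trans ?_, _,
      fun t ht => (hf' t ht).mul (hg' t ht), hfg.mono (le_of_eq (by ring))⟩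
    exact le_mul_of_one_le_left (by positivity) (one_le_pow₀ one_le_two)

theorem comp_neg (hf : DerivsBdd η C N f) : DerivsBdd η C N fun t => f (-t) := by
  have hmem : ∀ t ∈ Set.Ioo (-η) η, -t ∈ Set.Ioo (-η) η := fun t ht =>
    ⟨neg_lt_neg ht.2, by linarith [ht.1]⟩
  -- Each differentiation of `f (-t)` changes the sign, so the induction needs a factor of modulus
  -- one.
  suffices h : ∀ s : ℝ, |s| = 1 → ∀ f, DerivsBdd η C N f → DerivsBdd η C N fun t => s * f (-t) by
    simpa using h 1 (by simp) f hf
  clear hf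
  have key : ∀ s x : ℝ, |s| = 1 → |s * x| = |x| := fun s x hs => by rw [abs_mul, hs, one_mul]
  induction N with
  | zero => exact fun s hs f hf t ht => by rw [key s _ hs]; exact hf _ (hmem t ht)
  | succ N ih =>
    rintro s hs f ⟨h₀, f', hf', h₁⟩
    refine ⟨fun t ht => by rw [key s _ hs]; exact h₀ _ (hmem t ht), fun t => -s * f' (-t),
      fun t ht => ?_, ih (-s) (by rwa [abs_neg]) f' h₁⟩
    have := ((hf' (-t) (hmem t ht)).scomp t (hasDerivAt_neg t)).const_mul s
    simpa [Function.comp_def] using this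

theorem of_boundedDerivsNearZero {M : ℝ} (hf : BoundedDerivsNearZero f N η M) (hM : M ≤ C)
    (hC : ∀ t ∈ Set.Ioo (-η) η, |f t| ≤ C) : DerivsBdd η C N f := by
  induction N generalizing f with
  | zero => exact hC
  | succ N ih =>
    refine ⟨hC, deriv f, fun t ht => ?_, ih (fun k hk t ht => ?_) fun t ht => ?_⟩
    · simpa using (hf 0 N.succ_pos t ht).1.hasDerivAt
    · simpa only [← iteratedDeriv_succ'] using hf (k + 1) (by lia) t ht
    · simpa using (hf 0 N.succ_pos t ht).2.trans hM

/-- If `|f'| ≤ K` on the interval between `x` and `y`, then `|f y - f x| ≤ K |y - x|`. -/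
theorem abs_sub_le_of_deriv {f f' : ℝ → ℝ} {K x y : ℝ}
    (hf : ∀ s ∈ Set.uIcc x y, HasDerivAt f (f' s) s) (hK : ∀ s ∈ Set.uIcc x y, |f' s| ≤ K) :
    |f y - f x| ≤ K * |y - x| := by
  simpa using (convex_uIcc x y).norm_image_sub_le_of_norm_hasDerivWithin_le
    (fun s hs => (hf s hs).hasDerivWithinAt) hK Set.left_mem_uIcc Set.right_mem_uIcc

theorem uIcc_subset {x y : ℝ} (hx : x ∈ Set.Ioo (-η) η) (hy : y ∈ Set.Ioo (-η) η) :
    Set.uIcc x y ⊆ Set.Ioo (-η) η :=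
  Set.ordConnected_Ioo.uIcc_subset hx hy

theorem lipschitz (hf : DerivsBdd η C (N + 1) f) {x y : ℝ} (hx : x ∈ Set.Ioo (-η) η)
    (hy : y ∈ Set.Ioo (-η) η) : |f y - f x| ≤ C * |y - x| := by
  obtain ⟨_, f', hf', h₁⟩ := hf
  exact abs_sub_le_of_deriv (fun s hs => hf' s (uIcc_subset hx hy hs))
    fun s hs => h₁.bound s (uIcc_subset hx hy hs)

/-- Taylor expansion at `0`. -/
theorem taylor (hη : 0 < η) (hC : 0 ≤ C) (hf : DerivsBdd η C (N + 1) f) :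
    ∃ c : ℕ → ℝ, c 0 = f 0 ∧
      ∀ t ∈ Set.Ioo (-η) η, |f t - ∑ j ∈ Finset.range (N + 1), c j * t ^ j| ≤ C * |t| ^ (N + 1) := by
  have h0 : (0 : ℝ) ∈ Set.Ioo (-η) η := ⟨by linarith, hη⟩
  induction N generalizing f with
  | zero => exact ⟨fun _ => f 0, rfl, fun t ht => by simpa using hf.lipschitz h0 ht⟩
  | succ N ih =>
    obtain ⟨-, f', hf', h₁⟩ := hf
    obtain ⟨d, -, hd⟩ := ih h₁
    -- The coefficients are obtained by integrating the expansion of `f'`. The remainder then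
    -- follows from the mean value inequality between `0` and `t`.
    refine ⟨fun j => Nat.casesOn j (f 0) fun i => d i / (i + 1), rfl, fun t ht => ?_⟩
    let c : ℕ → ℝ := fun j => Nat.casesOn j (f 0) fun i => d i / (i + 1)
    have hsum : ∀ s, ∑ j ∈ Finset.range (N + 1 + 1), c j * s ^ j
        = f 0 + ∑ i ∈ Finset.range (N + 1), d i / (i + 1) * s ^ (i + 1) := fun s => by
      rw [Finset.sum_range_succ', add_comm]
      simp [c]
    have hder : ∀ s, HasDerivAt
        (fun s => ∑ i ∈ Finset.range (N + 1), d i / (i + 1) * s ^ (i + 1))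
        (∑ i ∈ Finset.range (N + 1), d i * s ^ i) s := fun s => by
      refine HasDerivAt.fun_sum fun i _ => ?_
      have := (hasDerivAt_pow (i + 1) s).const_mul (d i / (i + 1))
      convert! this using 1
      have : (i : ℝ) + 1 ≠ 0 := by positivity
      push_cast
      field_simp
    have hR := abs_sub_le_of_deriv (x := 0) (y := t) (K := C * |t| ^ (N + 1))
      (f := fun s => f s - ∑ i ∈ Finset.range (N + 1), d i / (i + 1) * s ^ (i + 1))
      (fun s hs => (hf' s (uIcc_subset h0 ht hs)).sub (hder s)) fun s hs => by
        refine (hd s (uIcc_subset h0 ht hs)).trans ?_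
        have : |s| ≤ |t| := by simpa using Set.abs_sub_left_of_mem_uIcc hs
        gcongr
    change |f t - ∑ j ∈ Finset.range (N + 1 + 1), c j * t ^ j| ≤ _
    rw [hsum]
    convert hR using 1
    · congr 1
      simp
      ring
    · rw [sub_zero]; ring

end DerivsBdd

/-! ### The smoother and its kernel -/

namespace IsSmoother

variable {H : ℝ → ℝ} {α : ℕ}

theorem deriv_eq_zero_of_lt (hH : IsSmoother H α) {x : ℝ} (hx : 1 < |x|) : deriv H x = 0 := by
  rcases lt_abs.1 hx with h | h
  · have : H =ᶠ[𝓝 x] fun _ => 1 := by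
      filter_upwards [lt_mem_nhds h] with y hy using hH.eq_one y hy
    simpa using this.deriv_eq
  · have : H =ᶠ[𝓝 x] fun _ => 0 := by
      filter_upwards [gt_mem_nhds (show x < -1 by linarith)] with y hy using hH.eq_zero y hy
    simpa using this.deriv_eq

theorem deriv_deriv_eq_zero_of_lt (hH : IsSmoother H α) {x : ℝ} (hx : 1 < |x|) :
    deriv (deriv H) x = 0 := by
  have : deriv H =ᶠ[𝓝 x] fun _ => 0 := by
    filter_upwards [continuous_abs.continuousAt.eventually (lt_mem_nhds hx)] with y hy
      using hH.deriv_eq_zero_of_lt hy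
  simpa using this.deriv_eq

theorem continuous_deriv (hH : IsSmoother H α) : Continuous (deriv H) :=
  hH.differentiable_deriv.continuous

theorem continuous_deriv_deriv (hH : IsSmoother H α) : Continuous (deriv (deriv H)) :=
  hH.lipschitz.choose_spec.continuous

/-- A continuous function that vanishes where `|x| > 1` vanishes where `|x| ≥ 1`. -/
theorem eq_zero_of_one_le_abs {f : ℝ → ℝ} (hf : Continuous f) (h : ∀ x, 1 < |x| → f x = 0)
    {x : ℝ} (hx : 1 ≤ |x|) : f x = 0 := by
  have hcl : IsClosed {x | f x = 0} := isClosed_eq hf continuous_const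
  rcases le_abs.1 hx with h1 | h1
  · have : closure (Set.Ioi (1 : ℝ)) ⊆ {x | f x = 0} :=
      closure_minimal (fun y hy => h y (lt_abs.2 (Or.inl hy))) hcl
    rw [closure_Ioi] at this
    exact this h1
  · have : closure (Set.Iio (-1 : ℝ)) ⊆ {x | f x = 0} :=
      closure_minimal (fun y (hy : y < -1) => h y (lt_abs.2 (Or.inr (by linarith)))) hcl
    rw [closure_Iio] at this
    exact this (show x ≤ -1 by linarith)

theorem deriv_eq_zero (hH : IsSmoother H α) {x : ℝ} (hx : 1 ≤ |x|) : deriv H x = 0 :=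
  eq_zero_of_one_le_abs hH.continuous_deriv (fun _ => hH.deriv_eq_zero_of_lt) hx

theorem deriv_deriv_eq_zero (hH : IsSmoother H α) {x : ℝ} (hx : 1 ≤ |x|) :
    deriv (deriv H) x = 0 :=
  eq_zero_of_one_le_abs hH.continuous_deriv_deriv (fun _ => hH.deriv_deriv_eq_zero_of_lt) hx

theorem integral_deriv (hH : IsSmoother H α) : ∫ x in (-1 : ℝ)..1, deriv H x = 1 := by
  have h1 : H 1 = 1 := by
    have : closure (Set.Ioi (1 : ℝ)) ⊆ {x | H x = 1} :=
      closure_minimal (fun y hy => hH.eq_one y hy)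
        (isClosed_eq hH.differentiable.continuous continuous_const)
    rw [closure_Ioi] at this
    exact this Set.self_mem_Ici
  have h2 : H (-1) = 0 := by
    have : closure (Set.Iio (-1 : ℝ)) ⊆ {x | H x = 0} :=
      closure_minimal (fun y hy => hH.eq_zero y hy)
        (isClosed_eq hH.differentiable.continuous continuous_const)
    rw [closure_Iio] at this
    exact this Set.self_mem_Iic
  rw [intervalIntegral.integral_deriv_eq_sub (fun x _ => hH.differentiable x)
    (hH.continuous_deriv.intervalIntegrable _ _), h1, h2, sub_zero]

end IsSmoother

/-- `B` bounds `H'`, `H''` and the Lipschitz constant of `H''`. -/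
structure SmootherBound (H : ℝ → ℝ) (B : ℝ) : Prop where
  pos : 0 < B
  deriv_le : ∀ x, |deriv H x| ≤ B
  deriv_deriv_le : ∀ x, |deriv (deriv H) x| ≤ B
  lipschitz : ∀ x y, |deriv (deriv H) x - deriv (deriv H) y| ≤ B * |x - y|

theorem IsSmoother.exists_bound {H : ℝ → ℝ} {α : ℕ} (hH : IsSmoother H α) :
    ∃ B, SmootherBound H B := by
  obtain ⟨C, hC⟩ := hH.bounded
  obtain ⟨K, hK⟩ := hH.lipschitz
  have hC0 : 0 ≤ C := (abs_nonneg _).trans (hC 0)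
  -- On `[-1, 1]` one has `|H' x| = |H' x - H' 1| ≤ C |x - 1| ≤ 2 C`; the summand `1` makes the
  -- bound positive.
  refine ⟨2 * C + K + 1, by positivity, fun x => ?_, fun x => (hC x).trans ?_, fun x y => ?_⟩
  · rcases le_total 1 |x| with h | h
    · rw [hH.deriv_eq_zero h, abs_zero]; positivity
    · have h1 := DerivsBdd.abs_sub_le_of_deriv (x := 1) (y := x)
        (fun s _ => (hH.differentiable_deriv s).hasDerivAt) fun s _ => hC s
      rw [hH.deriv_eq_zero (x := 1) (by simp), sub_zero] at h1
      have h2 : |x - 1| ≤ 2 := by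
        rw [abs_le] at h ⊢
        constructor <;> linarith
      have := mul_le_mul_of_nonneg_left h2 hC0
      have := K.2
      linarith
  · have := K.2
    linarith
  · have := hK.dist_le_mul x y
    rw [Real.dist_eq, Real.dist_eq] at this
    refine this.trans (mul_le_mul_of_nonneg_right ?_ (abs_nonneg _))
    linarith

/-- Substitution `t = h s - a` in an integral against a rescaled function supported in
`[-1, 1]`. -/
theorem integral_mul_comp_div (g Φ : ℝ → ℝ) (hΦ : ∀ x, 1 ≤ |x| → Φ x = 0) {h : ℝ} (hh : 0 < h)
    (a : ℝ) :
    ∫ t, g t * Φ ((t + a) / h) = h * ∫ s in (-1 : ℝ)..1, g (h * s - a) * Φ s := by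
  have h1 : ∫ s in (-1 : ℝ)..1, g (h * s - a) * Φ s = ∫ s, g (h * s - a) * Φ s := by
    rw [intervalIntegral.integral_of_le (by norm_num)]
    refine setIntegral_eq_integral_of_forall_compl_eq_zero fun x hx => ?_
    rw [hΦ x, mul_zero]
    rw [Set.mem_Ioc, not_and_or, not_lt, not_le] at hx
    rcases hx with hx | hx
    · exact le_abs.2 (Or.inr (by linarith))
    · exact le_abs.2 (Or.inl hx.le)
  have h2 := Measure.integral_comp_mul_left (fun t => g (t - a) * Φ (t / h)) h
  have h3 := integral_sub_right_eq_self (fun t => g t * Φ ((t + a) / h)) (μ := volume) a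
  simp only [sub_add_cancel] at h3
  rw [h1, ← h3]
  simp only [mul_div_cancel_left₀ _ hh.ne'] at h2
  rw [h2, smul_eq_mul, abs_of_pos (inv_pos.2 hh), mul_inv_cancel_left₀ hh.ne']

/-! ### Bias of kernel integrals -/

section Kernel

variable {H : ℝ → ℝ} {α : ℕ} {B η C h a : ℝ} {g g' : ℝ → ℝ}

theorem mem_Ioo_of_add_lt (hh : 0 < h) (ha : h + |a| < η) {s : ℝ} (hs : s ∈ Set.uIcc (-1 : ℝ) 1) :
    h * s - a ∈ Set.Ioo (-η) η := by
  rw [Set.uIcc_of_le (by norm_num)] at hs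
  have h1 := neg_abs_le a
  have h2 := le_abs_self a
  constructor <;> nlinarith [hs.1, hs.2]

theorem continuousOn_comp_affine (hg : ContinuousOn g (Set.Ioo (-η) η)) (hh : 0 < h)
    (ha : h + |a| < η) : ContinuousOn (fun s => g (h * s - a)) (Set.uIcc (-1 : ℝ) 1) :=
  hg.comp (by fun_prop) fun _ hs => mem_Ioo_of_add_lt hh ha hs

theorem abs_integral_mul_deriv_le (hB : SmootherBound H B) {u : ℝ → ℝ} {K : ℝ} (hK : 0 ≤ K)
    (hu : ∀ s ∈ Set.uIcc (-1 : ℝ) 1, |u s| ≤ K) :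
    |∫ s in (-1 : ℝ)..1, u s * deriv H s| ≤ 2 * B * K := by
  have := intervalIntegral.norm_integral_le_of_norm_le_const (a := -1) (b := 1) (C := K * B)
    (f := fun s => u s * deriv H s) fun s hs => by
      rw [norm_mul]
      exact mul_le_mul (hu s (Set.uIoc_subset_uIcc hs)) (hB.deriv_le s) (abs_nonneg _) hK
  rw [Real.norm_eq_abs] at this
  refine this.trans (le_of_eq ?_)
  norm_num
  ring

/-- A kernel of order `α` integrates to `O(h ^ α)` against a smooth function that vanishes
at `0`. -/
theorem abs_integral_comp_mul_deriv_le (hH : IsSmoother H α) (hB : SmootherBound H B)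
    (hC : 0 ≤ C) (hg : DerivsBdd η C α g) (hg0 : g 0 = 0) (hh : 0 < h) (hhη : h < η) :
    |∫ s in (-1 : ℝ)..1, g (h * s) * deriv H s| ≤ 2 * B * (C * h ^ α) := by
  have h2 := hH.two_le
  obtain ⟨N, rfl⟩ : ∃ N, α = N + 1 := ⟨α - 1, by lia⟩
  obtain ⟨c, hc0, hc⟩ := hg.taylor (hh.trans hhη) hC
  have hmem : ∀ s ∈ Set.uIcc (-1 : ℝ) 1, h * s ∈ Set.Ioo (-η) η := fun s hs => by
    simpa using mem_Ioo_of_add_lt (a := 0) hh (by simpa using hhη) hs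
  have hgc : ContinuousOn g (Set.Ioo (-η) η) := by
    obtain ⟨-, g', hg', -⟩ := hg
    exact fun t ht => (hg' t ht).continuousAt.continuousWithinAt
  have hgi : IntervalIntegrable (fun s => g (h * s) * deriv H s) volume (-1) 1 :=
    ((hgc.comp (by fun_prop) hmem).mul hH.continuous_deriv.continuousOn).intervalIntegrable
  have hpi : ∀ j, IntervalIntegrable (fun s => c j * h ^ j * (s ^ j * deriv H s)) volume (-1) 1 :=
    fun j => Continuous.intervalIntegrable
      (continuous_const.mul ((continuous_pow j).mul hH.continuous_deriv)) _ _
  -- In the Taylor polynomial the constant term is `g 0 = 0`, and the moment conditions remove the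
  -- powers `1, …, α - 1`. Only the remainder is left.
  have hzero : ∫ s in (-1 : ℝ)..1, ∑ j ∈ Finset.range (N + 1),
      c j * h ^ j * (s ^ j * deriv H s) = 0 := by
    rw [intervalIntegral.integral_finsetSum fun j _ => hpi j]
    refine Finset.sum_eq_zero fun j hj => ?_
    rw [intervalIntegral.integral_const_mul]
    rcases Nat.eq_zero_or_pos j with rfl | hj0
    · rw [hc0, hg0]; simp
    · rw [hH.moment_eq_zero j hj0 (Finset.mem_range.1 hj), mul_zero]
  have heq : ∫ s in (-1 : ℝ)..1, g (h * s) * deriv H s = ∫ s in (-1 : ℝ)..1,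
      (g (h * s) - ∑ j ∈ Finset.range (N + 1), c j * (h * s) ^ j) * deriv H s := by
    rw [← sub_zero (∫ s in (-1 : ℝ)..1, g (h * s) * deriv H s), ← hzero,
      ← intervalIntegral.integral_sub hgi (by
        simpa only [Finset.sum_fn] using IntervalIntegrable.sum (Finset.range (N + 1)) fun j _ => hpi j)]
    refine intervalIntegral.integral_congr fun s _ => ?_
    simp only [sub_mul, Finset.sum_mul, mul_pow]
    congr 1
    exact Finset.sum_congr rfl fun j _ => by ring
  rw [heq]
  refine abs_integral_mul_deriv_le hB (by positivity) fun s hs => ?_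
  refine (hc _ (hmem s hs)).trans ?_
  rw [Set.uIcc_of_le (by norm_num)] at hs
  have : |h * s| ≤ h := by
    rw [abs_mul, abs_of_pos hh]
    exact mul_le_of_le_one_right hh.le (abs_le.2 hs)
  gcongr

/-- Integration by parts; the boundary terms vanish because `H' (±1) = 0`. The factor `h` gained
here offsets the extra `1 / h` carried by `H''`. -/
theorem integral_comp_mul_deriv_deriv (hH : IsSmoother H α)
    (hg : ∀ t ∈ Set.Ioo (-η) η, HasDerivAt g (g' t) t) (hg' : ContinuousOn g' (Set.Ioo (-η) η))
    (hh : 0 < h) (ha : h + |a| < η) :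
    ∫ s in (-1 : ℝ)..1, g (h * s - a) * deriv (deriv H) s
      = -(h * ∫ s in (-1 : ℝ)..1, g' (h * s - a) * deriv H s) := by
  have hu : ∀ s ∈ Set.uIcc (-1 : ℝ) 1,
      HasDerivAt (fun s => g (h * s - a)) (h * g' (h * s - a)) s := fun s hs => by
    have h1 : HasDerivAt (fun s => h * s - a) h s := by
      simpa using ((hasDerivAt_id s).const_mul h).sub_const a
    simpa [Function.comp_def] using (hg _ (mem_Ioo_of_add_lt hh ha hs)).scomp s h1
  rw [intervalIntegral.integral_mul_deriv_eq_deriv_mul hu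
    (fun s _ => (hH.differentiable_deriv s).hasDerivAt)
    ((continuousOn_const.mul (continuousOn_comp_affine hg' hh ha)).intervalIntegrable)
    (hH.continuous_deriv_deriv.intervalIntegrable _ _),
    hH.deriv_eq_zero (x := 1) (by simp), hH.deriv_eq_zero (x := -1) (by simp),
    ← intervalIntegral.integral_const_mul]
  simp [mul_assoc]

theorem continuousOn_of_hasDerivAt (hg : ∀ t ∈ Set.Ioo (-η) η, HasDerivAt g (g' t) t) :
    ContinuousOn g (Set.Ioo (-η) η) :=
  fun t ht => (hg t ht).continuousAt.continuousWithinAt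

theorem DerivsBdd.continuousOn {N : ℕ} (hg : DerivsBdd η C (N + 1) g) :
    ContinuousOn g (Set.Ioo (-η) η) := by
  obtain ⟨-, g', hg', -⟩ := hg
  exact continuousOn_of_hasDerivAt hg'

theorem abs_sub_sub_mul_le (hg : ∀ t ∈ Set.Ioo (-η) η, HasDerivAt g (g' t) t)
    (hC : 0 ≤ C) (hg' : DerivsBdd η C 1 g') {x y : ℝ} (hx : x ∈ Set.Ioo (-η) η)
    (hy : y ∈ Set.Ioo (-η) η) :
    |g y - g x - (y - x) * g' x| ≤ C * (y - x) ^ 2 := by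
  have := DerivsBdd.abs_sub_le_of_deriv (x := x) (y := y) (f := fun t => g t - t * g' x)
    (K := C * |y - x|)
    (fun s hs => (hg s (DerivsBdd.uIcc_subset hx hy hs)).sub ((hasDerivAt_id s).mul_const (g' x)))
    fun s hs => by
      have h1 := hg'.lipschitz hx (DerivsBdd.uIcc_subset hx hy hs)
      rw [one_mul]
      exact h1.trans (mul_le_mul_of_nonneg_left (Set.abs_sub_left_of_mem_uIcc hs) hC)
  rw [mul_assoc, ← sq, sq_abs] at this
  convert this using 2
  ring

/-- Bias of the gradient at a point at distance `a` after one linear correction. -/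
theorem abs_integral_newton_le (hH : IsSmoother H α) (hB : SmootherBound H B) (hC : 0 ≤ C)
    (hg : DerivsBdd η C α g) (hg0 : g 0 = 0) (hh : 0 < h) (ha : h + |a| < η) :
    |∫ s in (-1 : ℝ)..1, g (h * s - a) * (a / h * deriv (deriv H) s - deriv H s)|
      ≤ 2 * B * C * (a ^ 2 + h ^ α) := by
  obtain ⟨g', hg', h2⟩ := (hg.of_le hH.two_le).2
  have hc := continuousOn_of_hasDerivAt hg'
  have hc' := h2.continuousOn
  have hhη : h < η := lt_of_le_of_lt (le_add_of_nonneg_right (abs_nonneg a)) ha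
  have hmem0 : ∀ s ∈ Set.uIcc (-1 : ℝ) 1, h * s ∈ Set.Ioo (-η) η := fun s hs => by
    simpa using mem_Ioo_of_add_lt (a := 0) hh (by simpa using hhη) hs
  have i1 : IntervalIntegrable (fun s => g (h * s - a) * deriv H s) volume (-1) 1 :=
    ((continuousOn_comp_affine hc hh ha).mul hH.continuous_deriv.continuousOn).intervalIntegrable
  have i2 : IntervalIntegrable (fun s => g (h * s - a) * deriv (deriv H) s) volume (-1) 1 :=
    ((continuousOn_comp_affine hc hh ha).mul
      hH.continuous_deriv_deriv.continuousOn).intervalIntegrable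
  have i3 : IntervalIntegrable (fun s => g' (h * s - a) * deriv H s) volume (-1) 1 :=
    ((continuousOn_comp_affine hc' hh ha).mul hH.continuous_deriv.continuousOn).intervalIntegrable
  have i4 : IntervalIntegrable (fun s => g (h * s) * deriv H s) volume (-1) 1 :=
    ((hc.comp (by fun_prop) hmem0).mul hH.continuous_deriv.continuousOn).intervalIntegrable
  -- After integration by parts the integrand is `-(g (h s - a) + a g' (h s - a)) H' s`. The bracket
  -- is the linear approximation of `g (h s)` from the point `h s - a`; what is left is its error,
  -- `O(a²)`, and the bias at the true parameter.
  have e1 : ∫ s in (-1 : ℝ)..1, g (h * s - a) * (a / h * deriv (deriv H) s - deriv H s)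
      = (∫ s in (-1 : ℝ)..1,
          (g (h * s) - g (h * s - a) - (h * s - (h * s - a)) * g' (h * s - a)) * deriv H s)
        - ∫ s in (-1 : ℝ)..1, g (h * s) * deriv H s := by
    have : ∫ s in (-1 : ℝ)..1, g (h * s - a) * (a / h * deriv (deriv H) s - deriv H s)
        = a / h * (∫ s in (-1 : ℝ)..1, g (h * s - a) * deriv (deriv H) s)
          - ∫ s in (-1 : ℝ)..1, g (h * s - a) * deriv H s := by
      rw [← intervalIntegral.integral_const_mul,
        ← intervalIntegral.integral_sub (i2.const_mul _) i1]
      exact intervalIntegral.integral_congr fun s _ => by ring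
    have e2 : ∫ s in (-1 : ℝ)..1,
          (g (h * s) - g (h * s - a) - (h * s - (h * s - a)) * g' (h * s - a)) * deriv H s
        = (∫ s in (-1 : ℝ)..1, g (h * s) * deriv H s)
          - (∫ s in (-1 : ℝ)..1, g (h * s - a) * deriv H s)
          - a * ∫ s in (-1 : ℝ)..1, g' (h * s - a) * deriv H s := by
      rw [← intervalIntegral.integral_const_mul, ← intervalIntegral.integral_sub i4 i1,
        ← intervalIntegral.integral_sub (i4.sub i1) (i3.const_mul _)]
      exact intervalIntegral.integral_congr fun s _ => by ring
    rw [this, e2, integral_comp_mul_deriv_deriv hH hg' hc' hh ha]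
    field_simp
    ring
  have b1 := abs_integral_mul_deriv_le hB (K := C * a ^ 2) (by positivity)
    (u := fun s => g (h * s) - g (h * s - a) - (h * s - (h * s - a)) * g' (h * s - a))
    fun s hs => by
      have := abs_sub_sub_mul_le hg' hC h2 (mem_Ioo_of_add_lt hh ha hs) (hmem0 s hs)
      rwa [sub_sub_cancel] at this ⊢
  have b2 := abs_integral_comp_mul_deriv_le hH hB hC hg hg0 hh hhη
  rw [e1]
  refine (abs_sub _ _).trans ((add_le_add b1 b2).trans (le_of_eq ?_))
  ring

/-- Bias of the Hessian. -/
theorem abs_integral_hess_le (hH : IsSmoother H α) (hB : SmootherBound H B) (hC : 0 ≤ C)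
    (hg : ∀ t ∈ Set.Ioo (-η) η, HasDerivAt g (g' t) t) (hg' : DerivsBdd η C 1 g') (hh : 0 < h)
    (ha : h + |a| < η) :
    |h⁻¹ * (∫ s in (-1 : ℝ)..1, g (h * s - a) * deriv (deriv H) s) + g' 0|
      ≤ 2 * B * C * (h + |a|) := by
  have hη : 0 < η := lt_of_le_of_lt (by positivity) ha
  have i3 : IntervalIntegrable (fun s => g' (h * s - a) * deriv H s) volume (-1) 1 :=
    ((continuousOn_comp_affine hg'.continuousOn hh ha).mul
      hH.continuous_deriv.continuousOn).intervalIntegrable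
  -- Uses that `H'` has integral `1` to write `g' 0` as an integral as well.
  have e1 : h⁻¹ * (∫ s in (-1 : ℝ)..1, g (h * s - a) * deriv (deriv H) s) + g' 0
      = ∫ s in (-1 : ℝ)..1, (g' 0 - g' (h * s - a)) * deriv H s := by
    simp only [sub_mul]
    rw [intervalIntegral.integral_sub
      ((hH.continuous_deriv.intervalIntegrable _ _).const_mul _) i3,
      intervalIntegral.integral_const_mul, hH.integral_deriv,
      integral_comp_mul_deriv_deriv hH hg hg'.continuousOn hh ha]
    field_simp
    ring
  rw [e1]
  refine (abs_integral_mul_deriv_le hB (K := C * (h + |a|)) (by positivity)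
    fun s hs => ?_).trans (le_of_eq (by ring))
  refine (hg'.lipschitz (mem_Ioo_of_add_lt hh ha hs)
    ⟨by linarith, hη⟩).trans (mul_le_mul_of_nonneg_left ?_ hC)
  rw [Set.uIcc_of_le (by norm_num)] at hs
  have h1 := neg_abs_le a
  have h2 := le_abs_self a
  rw [abs_le]
  constructor <;> nlinarith [hs.1, hs.2]

end Kernel

theorem BoundedDerivsNearZero.mono {f : ℝ → ℝ} {N N' : ℕ} {η η' M M' : ℝ}
    (hf : BoundedDerivsNearZero f N η M) (hN : N' ≤ N) (hη : η' ≤ η) (hM : M ≤ M') :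
    BoundedDerivsNearZero f N' η' M' := fun k hk t ht =>
  have h := hf k (hk.trans_le hN) t (Set.Ioo_subset_Ioo (neg_le_neg hη) hη ht)
  ⟨h.1, h.2.trans hM⟩

/-- A probability density with bounded derivative near `0` is bounded near `0`. -/
theorem density_le_of_derivs {f : ℝ → ℝ} {η M : ℝ} (hη : 0 < η) (hM : 0 ≤ M)
    (hf1 : ∫⁻ t, ENNReal.ofReal (f t) ≤ 1) (hf : BoundedDerivsNearZero f 1 η M)
    {t : ℝ} (ht : t ∈ Set.Ioo (-η) η) : f t ≤ 1 / η + 2 * η * M := by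
  by_contra! hlt
  -- If `f t` exceeded the bound, `f` would be at least `1 / η` on an interval of length `2 η` and
  -- have mass at least `2`.
  have hge : ∀ s ∈ Set.Ioo (-η) η, 1 / η ≤ f s := fun s hs => by
    have h1 := DerivsBdd.abs_sub_le_of_deriv (f := f) (f' := deriv f) (x := s) (y := t) (K := M)
      (fun r hr => by
        simpa using (hf 0 one_pos r (DerivsBdd.uIcc_subset hs ht hr)).1.hasDerivAt)
      fun r hr => by simpa using (hf 0 one_pos r (DerivsBdd.uIcc_subset hs ht hr)).2
    have h2 : |t - s| ≤ 2 * η := abs_le.2 ⟨by linarith [ht.1, hs.2], by linarith [ht.2, hs.1]⟩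
    have h3 := (abs_le.1 (h1.trans (mul_le_mul_of_nonneg_left h2 hM))).2
    linarith
  have h2 : ENNReal.ofReal 2 ≤ 1 := calc
    ENNReal.ofReal 2 = ∫⁻ _ in Set.Ioo (-η) η, ENNReal.ofReal (1 / η) := by
      rw [setLIntegral_const, Real.volume_Ioo, ← ENNReal.ofReal_mul (by positivity)]
      congr 1
      field_simp
      ring
    _ ≤ ∫⁻ s in Set.Ioo (-η) η, ENNReal.ofReal (f s) :=
      setLIntegral_mono' measurableSet_Ioo fun s hs => ENNReal.ofReal_le_ofReal (hge s hs)
    _ ≤ ∫⁻ s, ENNReal.ofReal (f s) := setLIntegral_le_lintegral _ _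
    _ ≤ 1 := hf1
  norm_num at h2

variable {p : ℕ}

attribute [fun_prop] measurable_covX measurable_covZ measurable_noise

@[fun_prop]
theorem measurable_zeta (βs : Vec p) : Measurable (zeta βs) := by
  unfold zeta
  fun_prop

@[fun_prop]
theorem measurable_response (βs : Vec p) : Measurable (response βs) :=
  Measurable.ite (measurableSet_le measurable_const (by fun_prop)) measurable_const
    measurable_const

theorem abs_response (βs : Vec p) (w : Triple p) : |response βs w| = 1 := by
  unfold response
  split_ifs <;> simp

/-! ### Conditional laws given `Z` -/

section Population

variable (P : Measure (Triple p)) [IsProbabilityMeasure P]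

instance : IsProbabilityMeasure (P.map covZ) :=
  Measure.isProbabilityMeasure_map measurable_covZ.aemeasurable

/-- A lower bound on a conditional probability given `(X, Z)` is one given `Z`. -/
theorem le_condDistrib_noise_of_le {s : Set ℝ} (hs : MeasurableSet s) {c : ℝ}
    (h : ∀ᵐ v ∂(P.map fun w => (covX w, covZ w)),
      c ≤ (condDistrib noise (fun w => (covX w, covZ w)) P v).real s) :
    ∀ᵐ z ∂(P.map covZ), c ≤ (condDistrib noise covZ P z).real s := by
  have hmeas : Measurable fun w : Triple p => (covX w, covZ w) := by fun_prop
  have key : (fun _ => ENNReal.ofReal c) ≤ᵐ[P.map covZ] fun z => condDistrib noise covZ P z s := by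
    -- Over `{Z ∈ A}`, an event of `(X, Z)` too, both conditional probabilities integrate to the
    -- same joint probability.
    refine ae_le_of_forall_setLIntegral_le_of_sigmaFinite measurable_const fun A hA _ => ?_
    have h1 := setLIntegral_condDistrib_of_measurableSet (μ := P) (X := covZ) (Y := noise)
      measurable_covZ (by fun_prop) hs (t := covZ ⁻¹' A) ⟨A, hA, rfl⟩
    have h2 := setLIntegral_condDistrib_of_measurableSet (μ := P)
      (X := fun w => (covX w, covZ w)) (Y := noise) hmeas (by fun_prop) hs
      (t := covZ ⁻¹' A) ⟨Set.univ ×ˢ A, MeasurableSet.univ.prod hA, by ext; simp⟩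
    rw [setLIntegral_map hA (Kernel.measurable_coe _ hs) measurable_covZ, h1, ← h2,
      setLIntegral_const, Measure.map_apply measurable_covZ hA, ← setLIntegral_const]
    refine lintegral_mono_ae (ae_restrict_of_ae ?_)
    filter_upwards [ae_of_ae_map hmeas.aemeasurable h] with w hw
    exact ENNReal.ofReal_le_of_le_toReal hw
  filter_upwards [key] with z hz
  exact (ENNReal.ofReal_le_iff_le_toReal (measure_ne_top _ _)).1 hz

/-- What holds of the conditional laws of `ζ` and of `ε` given `Z = z`, for almost every `z`. -/
structure LocalModel (βs : Vec p) (ρ : Vec p → ℝ → ℝ) (α : ℕ) (η C : ℝ) (z : Vec p) : Prop where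
  density : condDistrib (zeta βs) covZ P z = volume.withDensity fun t => ENNReal.ofReal (ρ z t)
  nonneg : ∀ t, 0 ≤ ρ z t
  density_derivs : DerivsBdd η C α (ρ z)
  cdf_continuousAt : ∀ t ∈ Set.Ioo (-η) η, ContinuousAt (noiseCDF P z) t
  cdf_zero : noiseCDF P z 0 = 1 / 2
  drift_derivs : DerivsBdd η C α fun t => (2 * noiseCDF P z (-t) - 1) * ρ z t
  drift_deriv : HasDerivAt (fun t => (2 * noiseCDF P z (-t) - 1) * ρ z t)
    (-(2 * (ρ z 0 * deriv (noiseCDF P z) 0))) 0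
  cdf_differentiableAt : DifferentiableAt ℝ (noiseCDF P z) 0

/-- For `t < 0` the sets `(-∞, t]` and `[0, ∞)` are disjoint, so `F t ≤ 1/2`; continuity carries
this to `0`. -/
theorem noiseCDF_zero {z : Vec p} (hc : ContinuousAt (noiseCDF P z) 0)
    (h1 : 1 / 2 ≤ (condDistrib noise covZ P z).real (Set.Iic 0))
    (h2 : 1 / 2 ≤ (condDistrib noise covZ P z).real (Set.Ici 0)) : noiseCDF P z 0 = 1 / 2 := by
  refine le_antisymm ?_ h1
  have hle : ∀ t < 0, noiseCDF P z t ≤ 1 / 2 := fun t ht => by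
    have h3 : (condDistrib noise covZ P z).real (Set.Iic t ∪ Set.Ici 0)
        = noiseCDF P z t + (condDistrib noise covZ P z).real (Set.Ici 0) :=
      measureReal_union (Set.disjoint_left.2 fun x hx hx' => by
        have : x ≤ t := hx
        have : 0 ≤ x := hx'
        linarith) measurableSet_Ici
    have h4 : (condDistrib noise covZ P z).real (Set.Iic t ∪ Set.Ici 0) ≤ 1 := measureReal_le_one
    linarith
  refine le_of_tendsto (hc.tendsto.mono_left (nhdsWithin_le_nhds (s := Set.Iio 0))) ?_
  filter_upwards [self_mem_nhdsWithin] with t ht using hle t ht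

-- Produces one neighbourhood and one constant that serve almost every `z`. The hypotheses bound the
-- derivatives uniformly but `ρ` itself only for each `z` separately; near `0` a uniform bound comes
-- from `density_le_of_derivs`. The drift is then handled by the sum and product rules of
-- `DerivsBdd`.
variable {P} in
theorem exists_localModel {βs : Vec p} {ρ : Vec p → ℝ → ℝ} {α : ℕ} (hα : 2 ≤ α)
    (hmedian : NoiseMedianZero P) (hρ : IsCondDensity P βs ρ) (hρ_reg : IndexDensityRegular P ρ α)
    (hF_reg : NoiseRegular P α) :
    ∃ η > 0, ∃ C ≥ 0, ∀ᵐ z ∂(P.map covZ), LocalModel P βs ρ α η C z := by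
  obtain ⟨η₁, hη₁, M₁, h₁⟩ := hρ_reg.derivs
  obtain ⟨η₂, hη₂, M₂, h₂⟩ := hF_reg.derivs
  set η := min η₁ η₂ with hη_def
  have hη : 0 < η := lt_min hη₁ hη₂
  set D := 1 / η + 2 * η * |M₁| + |M₁| + 1 + |M₂| with hD
  have hD0 : 0 ≤ D := by positivity
  have hηi : 0 ≤ 1 / η := by positivity
  have hηM : 0 ≤ 2 * η * |M₁| := by positivity
  -- `D` bounds `ρ`, `F` and their derivatives near `0`; the second summand is what the two products
  -- in `d3` yield for the drift.
  set C := D + 2 ^ α * ((2 ^ α * (|2| * D) + |-1|) * D) with hC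
  have hC' : 2 ^ α * ((2 ^ α * (|2| * D) + |-1|) * D) ≤ C := by linarith
  have hDC : D ≤ C := le_add_of_nonneg_right (by positivity)
  refine ⟨η, hη, C, by positivity, ?_⟩
  have m1 := le_condDistrib_noise_of_le P measurableSet_Iic (hmedian.mono fun _ h => h.1)
  have m2 := le_condDistrib_noise_of_le P measurableSet_Ici (hmedian.mono fun _ h => h.2)
  filter_upwards [h₁, h₂, m1, m2, hρ.condDistrib_eq, hρ_reg.pos] with z hz1 hz2 hm1 hm2 hd hpos
  have hM1 : |M₁| ≤ D := by have := abs_nonneg M₂; linarith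
  have hM2 : |M₂| ≤ D := by have := abs_nonneg M₁; linarith
  have b1 := hz1.mono le_rfl (min_le_left η₁ η₂) (le_abs_self M₁)
  have b2 := hz2.mono (Nat.le_succ α) (min_le_right η₁ η₂) (le_abs_self M₂)
  have hmass : ∫⁻ t, ENNReal.ofReal (ρ z t) ≤ 1 := by
    rw [← setLIntegral_univ, ← withDensity_apply _ MeasurableSet.univ, ← hd]
    exact prob_le_one
  have d1 : DerivsBdd η D α (ρ z) :=
    DerivsBdd.of_boundedDerivsNearZero b1 hM1 fun t ht => by
      rw [abs_of_pos (hpos t)]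
      refine (density_le_of_derivs hη (abs_nonneg M₁) hmass
        (b1.mono (by lia) le_rfl le_rfl) ht).trans ?_
      have := abs_nonneg M₁
      have := abs_nonneg M₂
      linarith
  have d2 : DerivsBdd η D α (noiseCDF P z) :=
    DerivsBdd.of_boundedDerivsNearZero b2 hM2 fun t _ => by
      have h0 : 0 ≤ noiseCDF P z t := measureReal_nonneg
      have h1 : noiseCDF P z t ≤ 1 := measureReal_le_one
      rw [abs_of_nonneg h0]
      have := abs_nonneg M₁
      have := abs_nonneg M₂
      linarith
  have d3 := (((DerivsBdd.const (2 : ℝ)).mul (by positivity) hD0 d2.comp_neg).add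
    (DerivsBdd.const (-1 : ℝ))).mul (by positivity) hD0 d1
  have hdiffF : ∀ t ∈ Set.Ioo (-η) η, DifferentiableAt ℝ (noiseCDF P z) t := fun t ht => by
    simpa using (b2 0 (by lia) t ht).1
  have h0 : (0 : ℝ) ∈ Set.Ioo (-η) η := ⟨by linarith, hη⟩
  have hF0 := noiseCDF_zero P (hdiffF 0 h0).continuousAt hm1 hm2
  have hρ0 : DifferentiableAt ℝ (ρ z) 0 := by simpa using (b1 0 (by lia) 0 h0).1
  refine ⟨hd, fun t => (hpos t).le, d1.mono hDC, fun t ht => (hdiffF t ht).continuousAt, hF0,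
    by simpa only [sub_eq_add_neg] using d3.mono hC', ?_, hdiffF 0 h0⟩
  have e1 : HasDerivAt (fun t => noiseCDF P z (-t)) (-deriv (noiseCDF P z) 0) 0 := by
    have h3 : HasDerivAt (noiseCDF P z) (deriv (noiseCDF P z) 0) (-0) := by
      rw [neg_zero]; exact (hdiffF 0 h0).hasDerivAt
    simpa [Function.comp_def] using h3.scomp (0 : ℝ) (hasDerivAt_neg 0)
  -- The term with `ρ'` drops out because `2 F(0) - 1 = 0`.
  have e2 := ((e1.const_mul 2).sub_const 1).mul hρ0.hasDerivAt
  convert! e2 using 1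
  simp only [neg_zero, hF0]
  ring

end Population

/-! ### Means of functions of the response and the index -/

section Population

variable {p : ℕ} {P : Measure (Triple p)} [IsProbabilityMeasure P]
  {βs : Vec p} {ρ : Vec p → ℝ → ℝ} {α : ℕ} {η C : ℝ}

/-- With `sign 0 = +1` the event `Y = -1` is the strict inequality `ε < -ζ`, so the open half-line
is needed; by continuity of `F` it has the same mass as the closed one. -/
theorem LocalModel.measure_Iio {z : Vec p} (hz : LocalModel P βs ρ α η C z) {t : ℝ}
    (ht : t ∈ Set.Ioo (-η) η) :
    (condDistrib noise covZ P z).real (Set.Iio t) = noiseCDF P z t := by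
  refine le_antisymm (measureReal_mono Set.Iio_subset_Iic_self) ?_
  refine le_of_tendsto
    ((hz.cdf_continuousAt t ht).tendsto.mono_left (nhdsWithin_le_nhds (s := Set.Iio t))) ?_
  filter_upwards [self_mem_nhdsWithin] with s hs
  exact measureReal_mono fun x (hx : x ≤ s) => lt_of_le_of_lt hx hs

theorem LocalModel.integral_sign {z : Vec p} (hz : LocalModel P βs ρ α η C z) {t : ℝ}
    (ht : t ∈ Set.Ioo (-η) η) :
    ∫ e, (-(if 0 ≤ t + e then 1 else -1) : ℝ) ∂(condDistrib noise covZ P z)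
      = 2 * noiseCDF P z (-t) - 1 := by
  have h1 : ∀ e : ℝ, (-(if 0 ≤ t + e then 1 else -1) : ℝ)
      = 2 * (Set.Iio (-t)).indicator 1 e - 1 := fun e => by
    by_cases he : 0 ≤ t + e
    · have : e ∉ Set.Iio (-t) := by simp only [Set.mem_Iio, not_lt]; linarith
      simp [he, this]
    · have : e ∈ Set.Iio (-t) := by simp only [Set.mem_Iio]; linarith
      simp only [he, if_false, Set.indicator_of_mem this, Pi.one_apply]
      norm_num
  simp only [h1]
  have hi : Integrable ((Set.Iio (-t)).indicator (1 : ℝ → ℝ)) (condDistrib noise covZ P z) :=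
    (integrable_const (1 : ℝ)).indicator measurableSet_Iio
  rw [integral_sub (hi.const_mul 2) (integrable_const _), integral_const_mul,
    integral_indicator_one measurableSet_Iio,
    hz.measure_Iio ⟨neg_lt_neg ht.2, by linarith [ht.1]⟩]
  simp

/-- The mean of `-Y φ(Z, ζ)` for a function `φ` which vanishes unless `ζ` is close to `0`. -/
theorem integral_neg_response_mul (hF : NoiseRegular P α)
    (hρ : IsCondDensity P βs ρ)
    (hloc : ∀ᵐ z ∂(P.map covZ), LocalModel P βs ρ α η C z) {φ : Vec p → ℝ → ℝ}
    (hφ : Measurable (Function.uncurry φ))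
    (hint : Integrable (fun w => φ (covZ w) (zeta βs w)) P)
    (hsupp : ∀ᵐ z ∂(P.map covZ), ∀ t ∉ Set.Ioo (-η) η, φ z t = 0) :
    Integrable (fun z => ∫ t, (2 * noiseCDF P z (-t) - 1) * ρ z t * φ z t) (P.map covZ) ∧
    ∫ w, -response βs w * φ (covZ w) (zeta βs w) ∂P
      = ∫ z, (∫ t, (2 * noiseCDF P z (-t) - 1) * ρ z t * φ z t) ∂(P.map covZ) := by
  have hmX : Measurable fun w : Triple p => (covZ w, covX w) := by fun_prop
  have hmζ : Measurable fun w : Triple p => (covZ w, zeta βs w) := by fun_prop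
  -- `q` is the integrand in terms of `((z, ζ), ε)`, `sh` passes from `(z, x)` to `(z, ζ)`, and `G`
  -- is `q` with the noise integrated out.
  let q : (Vec p × ℝ) × ℝ → ℝ := fun v => -(if 0 ≤ v.1.2 + v.2 then 1 else -1) * φ v.1.1 v.1.2
  have hq : Measurable q := by
    refine Measurable.mul (Measurable.neg (Measurable.ite ?_ measurable_const measurable_const))
      (hφ.comp measurable_fst)
    exact measurableSet_le measurable_const (by fun_prop)
  let sh : Vec p × ℝ → Vec p × ℝ := fun v => (v.1, v.2 + inner ℝ v.1 βs)
  have hsh : Measurable sh := by fun_prop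
  have hκ := (condIndepFun_iff_condDistrib_prod_ae_eq_prodMkRight
    (μ := P) (f := noise) (g := covX) (k := covZ) (by fun_prop) (by fun_prop)
      measurable_covZ).1 (CondIndepFun.symm hF.condIndep)
  let G : Vec p × ℝ → ℝ := fun v => ∫ e, q (v, e) ∂(condDistrib noise covZ P v.1)
  have hG : StronglyMeasurable G :=
    hq.stronglyMeasurable.integral_kernel_prod_right'
      (κ := (condDistrib noise covZ P).prodMkRight ℝ)
  have hqabs : ∀ v e, |q (v, e)| = |φ v.1 v.2| := fun v e => by
    simp only [q]
    split_ifs <;> simp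
  have hφG : ∀ v, |G v| ≤ |φ v.1 v.2| := fun v => by
    have := norm_integral_le_of_norm_le_const (μ := condDistrib noise covZ P v.1)
      (f := fun e => q (v, e)) (C := |φ v.1 v.2|)
      (Eventually.of_forall fun e => by rw [Real.norm_eq_abs, hqabs])
    simpa using this
  have hGi : Integrable (fun w => G (covZ w, zeta βs w)) P :=
    hint.mono ((hG.comp_measurable hmζ).aestronglyMeasurable)
      (Eventually.of_forall fun w => hφG _)
  have hGi' : Integrable G (P.map fun w => (covZ w, zeta βs w)) :=
    (integrable_map_measure hG.aestronglyMeasurable hmζ.aemeasurable).2 hGi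
  have s1 : ∫ w, -response βs w * φ (covZ w) (zeta βs w) ∂P
      = ∫ w, G (covZ w, zeta βs w) ∂P := by
    let q' : (Vec p × ℝ) × ℝ → ℝ := fun v => q (sh v.1, v.2)
    have hq' : Measurable q' := hq.comp (by fun_prop)
    have hm3 : Measurable fun w : Triple p => ((covZ w, covX w), noise w) := by fun_prop
    have hi : Integrable q' (P.map fun w => ((covZ w, covX w), noise w)) := by
      refine (integrable_map_measure hq'.aestronglyMeasurable hm3.aemeasurable).2 ?_
      refine hint.mono (hq'.comp hm3).aestronglyMeasurable (Eventually.of_forall fun w => ?_)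
      exact (hqabs _ _).le
    have e1 : ∫ w, -response βs w * φ (covZ w) (zeta βs w) ∂P
        = ∫ v, q' v ∂(P.map fun w => ((covZ w, covX w), noise w)) := by
      rw [integral_map hm3.aemeasurable hq'.aestronglyMeasurable]
      rfl
    rw [e1, ← compProd_map_condDistrib (X := fun w : Triple p => (covZ w, covX w))
      measurable_noise.aemeasurable, Measure.integral_compProd (by
        rwa [compProd_map_condDistrib measurable_noise.aemeasurable])]
    -- Conditional independence: the law of `ε` given `(Z, X)` is its law given `Z`.
    have e2 : (fun v => ∫ e, q' (v, e) ∂(condDistrib noise (fun w => (covZ w, covX w)) P v))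
        =ᵐ[P.map fun w => (covZ w, covX w)] fun v => G (sh v) := by
      filter_upwards [hκ] with v hv
      rw [hv]
      rfl
    rw [integral_congr_ae e2]
    exact integral_map (f := fun v => G (sh v)) hmX.aemeasurable
      (hG.comp_measurable hsh).aestronglyMeasurable
  have hinner : (fun z => ∫ t, G (z, t) ∂(condDistrib (zeta βs) covZ P z)) =ᵐ[P.map covZ]
      fun z => ∫ t, (2 * noiseCDF P z (-t) - 1) * ρ z t * φ z t := by
    filter_upwards [hloc, hsupp] with z hz hs
    have hρz : Measurable (ρ z) := hρ.measurable.comp measurable_prodMk_left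
    rw [hz.density, integral_withDensity_eq_integral_toReal_smul hρz.ennreal_ofReal
      (Eventually.of_forall fun _ => ENNReal.ofReal_lt_top)]
    refine integral_congr_ae (Eventually.of_forall fun t => ?_)
    simp only [smul_eq_mul]
    rw [ENNReal.toReal_ofReal (hz.nonneg t)]
    -- The formula for the mean of the sign is available near `0` only; elsewhere `φ` vanishes.
    by_cases ht : t ∈ Set.Ioo (-η) η
    · have : G (z, t) = (2 * noiseCDF P z (-t) - 1) * φ z t := by
        simp only [G, q]
        rw [integral_mul_const, hz.integral_sign ht]
      rw [this]
      ring
    · have : G (z, t) = 0 := by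
        have := hφG (z, t)
        simp only [hs t ht, abs_zero] at this
        exact abs_nonpos_iff.1 this
      rw [this, hs t ht]
      ring
  have hGc : Integrable G ((P.map covZ) ⊗ₘ condDistrib (zeta βs) covZ P) := by
    rwa [compProd_map_condDistrib (measurable_zeta βs).aemeasurable]
  refine ⟨(hGi'.integral_condDistrib_map (measurable_zeta βs).aemeasurable).congr hinner, ?_⟩
  rw [s1, ← integral_congr_ae hinner, ← Measure.integral_compProd hGc,
    compProd_map_condDistrib (measurable_zeta βs).aemeasurable,
    integral_map hmζ.aemeasurable hG.aestronglyMeasurable]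

/-- The index `ζ` falls into a small interval around `0` with a probability of the order of its
length. -/
theorem measure_zeta_Ioo_le (hloc : ∀ᵐ z ∂(P.map covZ), LocalModel P βs ρ α η C z)
    {r : ℝ} (hr : r ≤ η) :
    P (zeta βs ⁻¹' Set.Ioo (-r) r) ≤ ENNReal.ofReal (2 * C * r) := by
  have h1 := setLIntegral_preimage_condDistrib (μ := P) (X := covZ) (Y := zeta βs)
    measurable_covZ (by fun_prop) (measurableSet_Ioo (a := -r) (b := r)) MeasurableSet.univ
  simp only [Set.preimage_univ, Set.univ_inter, Measure.restrict_univ] at h1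
  rw [← h1]
  have h2 : ∀ᵐ w ∂P, condDistrib (zeta βs) covZ P (covZ w) (Set.Ioo (-r) r)
      ≤ ENNReal.ofReal (2 * C * r) := by
    filter_upwards [ae_of_ae_map measurable_covZ.aemeasurable hloc] with w hw
    rw [hw.density, withDensity_apply _ measurableSet_Ioo]
    calc ∫⁻ t in Set.Ioo (-r) r, ENNReal.ofReal (ρ (covZ w) t)
        ≤ ∫⁻ _ in Set.Ioo (-r) r, ENNReal.ofReal C :=
          setLIntegral_mono' measurableSet_Ioo fun t ht => ENNReal.ofReal_le_ofReal
            ((le_abs_self _).trans (hw.density_derivs.bound t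
              (Set.Ioo_subset_Ioo (neg_le_neg hr) hr ht)))
      _ = ENNReal.ofReal C * ENNReal.ofReal (r - -r) := by
          rw [setLIntegral_const, Real.volume_Ioo]
      _ ≤ ENNReal.ofReal (2 * C * r) := by
          rcases le_total 0 C with hC | hC
          · rw [← ENNReal.ofReal_mul hC]
            exact ENNReal.ofReal_le_ofReal (le_of_eq (by ring))
          · simp [ENNReal.ofReal_of_nonpos hC]
  simpa using lintegral_mono_ae h2

/-- The support has probability at most `2 C r`. This small factor is what makes the variances one
power of `h` smaller than the squared envelope. -/
theorem integral_sq_le (hloc : ∀ᵐ z ∂(P.map covZ), LocalModel P βs ρ α η C z) (hC : 0 ≤ C)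
    {r K : ℝ} (hr0 : 0 ≤ r) (hr : r ≤ η) {f : Triple p → ℝ} (hf : ∀ᵐ w ∂P, |f w| ≤ K)
    (hsupp : ∀ᵐ w ∂P, zeta βs w ∉ Set.Ioo (-r) r → f w = 0) :
    ∫ w, f w ^ 2 ∂P ≤ K ^ 2 * (2 * C * r) := by
  have hS : MeasurableSet (zeta βs ⁻¹' Set.Ioo (-r) r) := measurable_zeta βs measurableSet_Ioo
  calc ∫ w, f w ^ 2 ∂P
      ≤ ∫ w, (zeta βs ⁻¹' Set.Ioo (-r) r).indicator (fun _ => K ^ 2) w ∂P := by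
        refine integral_mono_of_nonneg (Eventually.of_forall fun w => sq_nonneg _)
          ((integrable_const _).indicator hS) ?_
        filter_upwards [hf, hsupp] with w h1 h2
        by_cases hw : zeta βs w ∈ Set.Ioo (-r) r
        · rw [Set.indicator_of_mem (by exact hw), ← sq_abs]
          exact pow_le_pow_left₀ (abs_nonneg _) h1 2
        · rw [Set.indicator_of_notMem (by exact hw), h2 hw]
          simp
    _ = P.real (zeta βs ⁻¹' Set.Ioo (-r) r) * K ^ 2 := by
        rw [integral_indicator_const _ hS, smul_eq_mul]
    _ ≤ (2 * C * r) * K ^ 2 :=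
        mul_le_mul_of_nonneg_right
          (ENNReal.toReal_le_of_le_ofReal (by positivity) (measure_zeta_Ioo_le hloc hr))
          (sq_nonneg _)
    _ = K ^ 2 * (2 * C * r) := mul_comm _ _

end Population

/-! ### Deviation inequalities for empirical means -/

section EmpiricalProcess

variable {Ω T ι : Type*} [MeasurableSpace Ω] [MeasurableSpace T] [Fintype ι]
  {μ : Measure Ω} [IsProbabilityMeasure μ] {P : Measure T} [IsProbabilityMeasure P]
  {W : ι → Ω → T}

/-- The deviation of the empirical mean of `f` over the sample `W` from its mean under `P`. -/
noncomputable def empDev (P : Measure T) (W : ι → Ω → T) (f : T → ℝ) (ω : Ω) : ℝ :=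
  (Fintype.card ι : ℝ)⁻¹ * ∑ i, f (W i ω) - ∫ x, f x ∂P

theorem ae_forall_of_hasLaw (hW : ∀ i, HasLaw (W i) P μ) {q : T → Prop} (hq : ∀ᵐ x ∂P, q x) :
    ∀ᵐ ω ∂μ, ∀ i, q (W i ω) :=
  ae_all_iff.2 fun i => ae_of_ae_map (hW i).aemeasurable ((hW i).map_eq.symm ▸ hq)

theorem integrable_of_ae_abs_le {f : T → ℝ} (hf : Measurable f) {K : ℝ}
    (hK : ∀ᵐ x ∂P, |f x| ≤ K) : Integrable f P :=
  Integrable.of_bound hf.aestronglyMeasurable K hK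

theorem memLp_of_ae_abs_le {f : T → ℝ} (hf : Measurable f) {K : ℝ}
    (hK : ∀ᵐ x ∂P, |f x| ≤ K) : MemLp f 2 P :=
  MemLp.of_bound hf.aestronglyMeasurable K hK

theorem abs_integral_le_of_ae {f : T → ℝ} {K : ℝ} (hK : ∀ᵐ x ∂P, |f x| ≤ K) :
    |∫ x, f x ∂P| ≤ K := by
  simpa using norm_integral_le_of_norm_le_const (μ := P) (f := f) hK

/-- The condition on `l` keeps the exponent in `[-1, 1]`, where `exp x ≤ 1 + x + x²`. The linear
term has mean zero and the quadratic one is a variance. -/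
theorem mgf_sub_integral_le {f : T → ℝ} (hf : Measurable f) {K S l : ℝ}
    (hK : ∀ᵐ x ∂P, |f x| ≤ K) (hS : ∫ x, f x ^ 2 ∂P ≤ S) (hl0 : 0 ≤ l) (hl : 2 * K * l ≤ 1) :
    ∫ x, Real.exp (l * (f x - ∫ y, f y ∂P)) ∂P ≤ Real.exp (l ^ 2 * S) := by
  set m := ∫ y, f y ∂P with hm
  have hmK : |m| ≤ K := abs_integral_le_of_ae hK
  have hfi := integrable_of_ae_abs_le hf hK
  have hf2 : Integrable (fun x => (f x - m) ^ 2) P :=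
    ((memLp_of_ae_abs_le hf hK).sub (memLp_const m)).integrable_sq
  have hvar : ∫ x, (f x - m) ^ 2 ∂P ≤ S := by
    have h1 := variance_le_expectation_sq (μ := P) (X := f) hf.aestronglyMeasurable
    rw [variance_eq_integral hf.aemeasurable] at h1
    exact h1.trans hS
  have hle : ∀ᵐ x ∂P, Real.exp (l * (f x - m)) ≤ 1 + (l * (f x - m) + l ^ 2 * (f x - m) ^ 2) := by
    filter_upwards [hK] with x hx
    have h1 : |f x - m| ≤ 2 * K := (abs_sub _ _).trans (by linarith)
    have h2 : |l * (f x - m)| ≤ 1 := by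
      rw [abs_mul, abs_of_nonneg hl0]
      nlinarith
    have h3 := (abs_le.1 (Real.abs_exp_sub_one_sub_id_le h2)).2
    nlinarith
  have hi1 : Integrable (fun x => l * (f x - m)) P := (hfi.sub (integrable_const m)).const_mul l
  have hi2 : Integrable (fun x => l ^ 2 * (f x - m) ^ 2) P := hf2.const_mul _
  calc ∫ x, Real.exp (l * (f x - m)) ∂P
      ≤ ∫ x, (1 + (l * (f x - m) + l ^ 2 * (f x - m) ^ 2)) ∂P :=
        integral_mono_of_nonneg (Eventually.of_forall fun _ => (Real.exp_pos _).le)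
          ((integrable_const _).add (hi1.add hi2)) hle
    _ = 1 + l ^ 2 * ∫ x, (f x - m) ^ 2 ∂P := by
        have hc : ∫ x, (f x - m) ∂P = 0 := by
          rw [integral_sub hfi (integrable_const m)]
          simp [hm]
        have h1 : ∫ x, (1 + (l * (f x - m) + l ^ 2 * (f x - m) ^ 2)) ∂P
            = ∫ _, (1 : ℝ) ∂P + ∫ x, (l * (f x - m) + l ^ 2 * (f x - m) ^ 2) ∂P :=
          integral_add (integrable_const _) (hi1.add hi2)
        rw [h1, integral_add hi1 hi2,
          integral_const_mul, integral_const_mul, hc]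
        simp
    _ ≤ l ^ 2 * S + 1 := by nlinarith [sq_nonneg l]
    _ ≤ Real.exp (l ^ 2 * S) := Real.add_one_le_exp _

/-- Chernoff's method: the exponential moments multiply by independence. -/
theorem measure_le_sum_le (hW : ∀ i, HasLaw (W i) P μ) (hind : iIndepFun W μ) {f : T → ℝ}
    (hf : Measurable f) {K S l : ℝ} (hK : ∀ᵐ x ∂P, |f x| ≤ K) (hS : ∫ x, f x ^ 2 ∂P ≤ S)
    (hl0 : 0 ≤ l) (hl : 2 * K * l ≤ 1) (t : ℝ) :
    μ {ω | Fintype.card ι * t ≤ ∑ i, (f (W i ω) - ∫ x, f x ∂P)}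
      ≤ ENNReal.ofReal (Real.exp (Fintype.card ι * (l ^ 2 * S - l * t))) := by
  set m := ∫ x, f x ∂P with hm
  let X : ι → Ω → ℝ := fun i ω => f (W i ω) - m
  have hXm : ∀ i, AEMeasurable (X i) μ := fun i =>
    (hf.comp_aemeasurable (hW i).aemeasurable).sub_const m
  have hXind : iIndepFun X μ := hind.comp (fun _ x => f x - m) fun _ => hf.sub_const m
  have hmgf : ∀ i, mgf (X i) μ l ≤ Real.exp (l ^ 2 * S) := fun i => by
    refine le_trans (le_of_eq ?_) (mgf_sub_integral_le hf hK hS hl0 hl)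
    exact (hW i).integral_comp (f := fun x => Real.exp (l * (f x - m)))
      (Measurable.aestronglyMeasurable (by fun_prop))
  have hsum : mgf (∑ i, X i) μ l ≤ Real.exp (Fintype.card ι * (l ^ 2 * S)) := by
    rw [hXind.mgf_sum₀ hXm]
    refine (Finset.prod_le_prod (fun i _ => mgf_nonneg) fun i _ => hmgf i).trans (le_of_eq ?_)
    rw [Finset.prod_const, Finset.card_univ, ← Real.exp_nat_mul]
  have hint : Integrable (fun ω => Real.exp (l * (∑ i, X i) ω)) μ := by
    refine Integrable.of_bound (C := Real.exp (Fintype.card ι * 1)) ?_ ?_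
    · exact (Real.measurable_exp.comp_aemeasurable
        ((Finset.aemeasurable_sum _ fun i _ => hXm i).const_mul l)).aestronglyMeasurable
    · have hmK : |m| ≤ K := abs_integral_le_of_ae hK
      filter_upwards [ae_forall_of_hasLaw hW hK] with ω hω
      rw [Real.norm_eq_abs, abs_of_pos (Real.exp_pos _)]
      refine Real.exp_le_exp.2 ?_
      rw [Finset.sum_apply, Finset.mul_sum]
      refine (Finset.sum_le_card_nsmul _ _ 1 fun i _ => ?_).trans (le_of_eq (by simp))
      have h1 : X i ω ≤ 2 * K := by
        have := (abs_le.1 (hω i)).2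
        have := (abs_le.1 hmK).1
        simp only [X]
        linarith
      nlinarith
  have hch := measure_ge_le_exp_mul_mgf (μ := μ) (X := ∑ i, X i) (t := l)
    (Fintype.card ι * t) hl0 hint
  rw [← ENNReal.ofReal_toReal (measure_ne_top μ _)]
  refine ENNReal.ofReal_le_ofReal ?_
  have hset : {ω | Fintype.card ι * t ≤ ∑ i, (f (W i ω) - m)}
      = {ω | Fintype.card ι * t ≤ (∑ i, X i) ω} := by
    ext ω
    simp [X, Finset.sum_apply]
  rw [hset]
  refine hch.trans ((mul_le_mul_of_nonneg_left hsum (Real.exp_pos _).le).trans (le_of_eq ?_))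
  rw [← Real.exp_add]
  congr 1
  ring

theorem empDev_eq (hι : 0 < Fintype.card ι) (f : T → ℝ) (ω : Ω) :
    empDev P W f ω = (Fintype.card ι : ℝ)⁻¹ * ∑ i, (f (W i ω) - ∫ x, f x ∂P) := by
  have : (Fintype.card ι : ℝ) ≠ 0 := by positivity
  rw [Finset.sum_sub_distrib, mul_sub, empDev]
  simp only [Finset.sum_const, Finset.card_univ, nsmul_eq_mul]
  rw [inv_mul_cancel_left₀ this]

/-- Bernstein-type tail bound for the empirical mean of a bounded function. -/
theorem measure_le_abs_empDev_le (hW : ∀ i, HasLaw (W i) P μ) (hind : iIndepFun W μ)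
    (hι : 0 < Fintype.card ι) {f : T → ℝ} (hf : Measurable f) {K S l : ℝ}
    (hK : ∀ᵐ x ∂P, |f x| ≤ K) (hS : ∫ x, f x ^ 2 ∂P ≤ S) (hl0 : 0 ≤ l) (hl : 2 * K * l ≤ 1)
    (t : ℝ) :
    μ {ω | t ≤ |empDev P W f ω|}
      ≤ ENNReal.ofReal (2 * Real.exp (Fintype.card ι * (l ^ 2 * S - l * t))) := by
  have hn : (0 : ℝ) < Fintype.card ι := by exact_mod_cast hι
  have h1 := measure_le_sum_le hW hind hf hK hS hl0 hl t
  have h2 := measure_le_sum_le hW hind (f := fun x => -f x) hf.neg (by simpa using hK)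
    (by simpa using hS) hl0 hl t
  rw [two_mul, ENNReal.ofReal_add (Real.exp_pos _).le (Real.exp_pos _).le]
  refine le_trans (measure_mono ?_) ((measure_union_le _ _).trans (add_le_add h1 h2))
  intro ω hω
  have hω' : t ≤ |empDev P W f ω| := hω
  rw [empDev_eq hι] at hω'
  rcases le_abs.1 hω' with h | h
  · left
    rw [Set.mem_ofPred_eq]
    rwa [inv_mul_eq_div, le_div_iff₀ hn, mul_comm] at h
  · right
    rw [Set.mem_ofPred_eq]
    rw [← mul_neg, inv_mul_eq_div, le_div_iff₀ hn, mul_comm] at h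
    refine h.trans (le_of_eq ?_)
    rw [integral_neg, ← Finset.sum_neg_distrib]
    exact Finset.sum_congr rfl fun i _ => by ring

/-- Chebyshev's inequality for the empirical mean. -/
theorem measure_lt_abs_empDev_le_div (hW : ∀ i, HasLaw (W i) P μ) (hind : iIndepFun W μ)
    (hι : 0 < Fintype.card ι) {f : T → ℝ} (hf : Measurable f) {K S t : ℝ}
    (hK : ∀ᵐ x ∂P, |f x| ≤ K) (hS : ∫ x, f x ^ 2 ∂P ≤ S) (ht : 0 < t) :
    μ {ω | t ≤ |empDev P W f ω|} ≤ ENNReal.ofReal (S / (Fintype.card ι * t ^ 2)) := by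
  have hn : (0 : ℝ) < Fintype.card ι := by exact_mod_cast hι
  let X : ι → Ω → ℝ := fun i ω => f (W i ω)
  have hXm : ∀ i, AEMeasurable (X i) μ := fun i => hf.comp_aemeasurable (hW i).aemeasurable
  have hL2 : ∀ i, MemLp (X i) 2 μ := fun i =>
    MemLp.of_bound (hXm i).aestronglyMeasurable K
      ((ae_forall_of_hasLaw hW hK).mono fun ω hω => hω i)
  have hmean : ∀ i, ∫ ω, X i ω ∂μ = ∫ x, f x ∂P := fun i =>
    (hW i).integral_comp hf.aestronglyMeasurable
  have hvar : ∀ i, Var[X i; μ] ≤ S := fun i => by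
    refine (variance_le_expectation_sq (hXm i).aestronglyMeasurable).trans ?_
    refine le_trans (le_of_eq ?_) hS
    exact (hW i).integral_comp (f := fun x => f x ^ 2)
      (Measurable.aestronglyMeasurable (by fun_prop))
  have hXind : iIndepFun X μ := hind.comp (fun _ => f) fun _ => hf
  have hsum : Var[∑ i, X i; μ] ≤ Fintype.card ι * S := by
    rw [IndepFun.variance_sum (fun i _ => hL2 i) fun i _ j _ hij => hXind.indepFun hij]
    refine (Finset.sum_le_card_nsmul _ _ S fun i _ => hvar i).trans (le_of_eq ?_)
    simp
  have hch := meas_ge_le_variance_div_sq (μ := μ) (X := ∑ i, X i)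
    (memLp_finsetSum' _ fun i _ => hL2 i) (mul_pos hn ht)
  have hmS : ∫ ω, (∑ i, X i) ω ∂μ = Fintype.card ι * ∫ x, f x ∂P := by
    simp only [Finset.sum_apply]
    rw [integral_finsetSum _ fun i _ => (hL2 i).integrable one_le_two]
    simp [hmean]
  refine le_trans (measure_mono fun ω hω => ?_) (hch.trans (ENNReal.ofReal_le_ofReal ?_))
  · have hω' : t ≤ |empDev P W f ω| := hω
    rw [Set.mem_ofPred_eq]
    have he : (∑ i, X i) ω - ∫ ω, (∑ i, X i) ω ∂μ = Fintype.card ι * empDev P W f ω := by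
      rw [hmS, empDev, mul_sub, mul_inv_cancel_left₀ hn.ne', Finset.sum_apply]
    rw [he, abs_mul, abs_of_pos hn]
    exact mul_le_mul_of_nonneg_left hω' hn.le
  · rw [div_le_div_iff₀ (by positivity) (by positivity)]
    have := mul_le_mul_of_nonneg_right hsum (show 0 ≤ Fintype.card ι * t ^ 2 by positivity)
    refine this.trans (le_of_eq (by ring))

/-- The deviation of the empirical mean inherits Lipschitz bounds. -/
theorem abs_empDev_sub_le {f g : T → ℝ} (hf : Integrable f P) (hg : Integrable g P) {K : ℝ}
    (hP : ∀ᵐ x ∂P, |f x - g x| ≤ K) {ω : Ω} (hω : ∀ i, |f (W i ω) - g (W i ω)| ≤ K)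
    (hι : 0 < Fintype.card ι) :
    |empDev P W f ω - empDev P W g ω| ≤ 2 * K := by
  have hn : (0 : ℝ) < Fintype.card ι := by exact_mod_cast hι
  have h1 : |(Fintype.card ι : ℝ)⁻¹ * ∑ i, (f (W i ω) - g (W i ω))| ≤ K := by
    rw [abs_mul, abs_of_pos (inv_pos.2 hn), inv_mul_le_iff₀ hn]
    refine (Finset.abs_sum_le_sum_abs _ _).trans
      ((Finset.sum_le_card_nsmul _ _ K fun i _ => hω i).trans (le_of_eq (by simp)))
  have h2 : |∫ x, (f x - g x) ∂P| ≤ K :=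
    abs_integral_le_of_ae hP
  have h3 : empDev P W f ω - empDev P W g ω
      = (Fintype.card ι : ℝ)⁻¹ * ∑ i, (f (W i ω) - g (W i ω)) - ∫ x, (f x - g x) ∂P := by
    rw [integral_sub hf hg, Finset.sum_sub_distrib, empDev, empDev]
    ring
  rw [h3]
  exact (abs_sub _ _).trans (by linarith)

/-- Every point of the cube of half-width `M` is close to a point of a grid. -/
theorem exists_grid_near {p n : ℕ} (hn : 0 < n) {M : ℝ} (hM : 0 < M) {u : Fin p → ℝ}
    (hu : ‖u‖ ≤ M) :
    ∃ c ∈ Fintype.piFinset fun _ : Fin p => Finset.Icc (-(n : ℤ)) n,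
      ‖u - fun j => M * c j / n‖ ≤ M / n := by
  have hn' : (0 : ℝ) < n := by exact_mod_cast hn
  have hub : ∀ j, |u j| ≤ M := (pi_norm_le_iff_of_nonneg hM.le).1 hu
  -- Round every coordinate down to the grid of mesh `M / n`.
  refine ⟨fun j => ⌊n * u j / M⌋, ?_, ?_⟩
  · rw [Fintype.mem_piFinset]
    intro j
    have h1 := abs_le.1 (hub j)
    rw [Finset.mem_Icc]
    constructor
    · rw [Int.le_floor]
      push_cast
      rw [le_div_iff₀ hM]
      nlinarith
    · have : (⌊n * u j / M⌋ : ℝ) ≤ n := (Int.floor_le _).trans (by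
        rw [div_le_iff₀ hM]
        nlinarith)
      exact_mod_cast this
  · refine (pi_norm_le_iff_of_nonneg (by positivity)).2 fun j => ?_
    have h1 := Int.floor_le (n * u j / M)
    have h2 := Int.lt_floor_add_one (n * u j / M)
    set c : ℝ := (⌊n * u j / M⌋ : ℝ) with hc
    rw [le_div_iff₀ hM] at h1
    rw [div_lt_iff₀ hM] at h2
    simp only [Pi.sub_apply, Real.norm_eq_abs]
    rw [abs_le]
    constructor
    · rw [neg_le_sub_iff_le_add, div_le_iff₀ hn', add_mul, div_mul_cancel₀ _ hn'.ne']
      linarith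
    · rw [sub_le_iff_le_add, ← add_div, le_div_iff₀ hn']
      linarith

theorem norm_grid_le {p n : ℕ} (hn : 0 < n) {M : ℝ} (hM : 0 < M) {c : Fin p → ℤ}
    (hc : c ∈ Fintype.piFinset fun _ : Fin p => Finset.Icc (-(n : ℤ)) n) :
    ‖fun j => M * c j / n‖ ≤ M := by
  have hn' : (0 : ℝ) < n := by exact_mod_cast hn
  refine (pi_norm_le_iff_of_nonneg hM.le).2 fun j => ?_
  have h1 := Finset.mem_Icc.1 (Fintype.mem_piFinset.1 hc j)
  have h2 : (-(n : ℝ)) ≤ c j := by exact_mod_cast h1.1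
  have h3 : (c j : ℝ) ≤ n := by exact_mod_cast h1.2
  rw [Real.norm_eq_abs, abs_le]
  constructor
  · rw [le_div_iff₀ hn']
    nlinarith
  · rw [div_le_iff₀ hn']
    nlinarith

/-- Uniform deviation bound for a parametric class of functions with envelope `C / h ^ 2`, second
moments `C / h ^ 3` and Lipschitz constant `C / h ^ 3`. -/
theorem measure_exists_lt_empDev_le (hW : ∀ i, HasLaw (W i) P μ) (hind : iIndepFun W μ)
    {p : ℕ} {f : T → (Fin p → ℝ) → ℝ} (hf : ∀ u, Measurable fun x => f x u) {M C h r : ℝ}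
    (hM : 0 < M) (hC : 0 ≤ C) (hh : 0 < h)
    (hb : ∀ᵐ x ∂P, ∀ u, ‖u‖ ≤ M → |f x u| ≤ C / h ^ 2)
    (hv : ∀ u, ‖u‖ ≤ M → ∫ x, f x u ^ 2 ∂P ≤ C / h ^ 3)
    (hl : ∀ᵐ x ∂P, ∀ u v, ‖u‖ ≤ M → ‖v‖ ≤ M → |f x u - f x v| ≤ C / h ^ 3 * ‖u - v‖)
    (hι : 3 ≤ Fintype.card ι)
    (hr : r = √(Real.log (Fintype.card ι) / (Fintype.card ι * h ^ 3)))
    (hr1 : r ≤ 1) (hr2 : 2 * C * h * r ≤ 1) :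
    μ {ω | ∃ u, ‖u‖ ≤ M ∧ (C + p + 1 + 2 * C * M) * r < |empDev P W (fun x => f x u) ω|}
      ≤ ENNReal.ofReal (2 * 3 ^ p / Fintype.card ι) := by
  set n := Fintype.card ι with hn
  have hn0 : 0 < n := by lia
  have hnr : (0 : ℝ) < n := by exact_mod_cast hn0
  have hlog : 1 ≤ Real.log n := by
    rw [Real.le_log_iff_exp_le hnr]
    have : (3 : ℝ) ≤ n := by exact_mod_cast hι
    linarith [Real.exp_one_lt_d9]
  have hr0 : 0 ≤ r := hr ▸ Real.sqrt_nonneg _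
  have hrsq : r ^ 2 = Real.log n / (n * h ^ 3) := by
    rw [hr, Real.sq_sqrt (by positivity)]
  have hrn : n * (h ^ 3 * r ^ 2) = Real.log n := by
    rw [hrsq]
    field_simp
  set G := Fintype.piFinset fun _ : Fin p => Finset.Icc (-(n : ℤ)) n with hG
  let v : (Fin p → ℤ) → Fin p → ℝ := fun c j => M * c j / n
  have hGcard : (G.card : ℝ) ≤ (3 * n) ^ p := by
    rw [hG, Fintype.card_piFinset]
    simp only [Int.card_Icc, Finset.prod_const, Finset.card_univ, Fintype.card_fin]
    have h1 : ((n : ℤ) + 1 - -(n : ℤ)).toNat = 2 * n + 1 := by lia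
    rw [h1]
    push_cast
    have : (1 : ℝ) ≤ n := by exact_mod_cast hn0
    exact pow_le_pow_left₀ (by positivity) (by linarith) p
  have hpt : ∀ c ∈ G, μ {ω | (C + p + 1) * r ≤ |empDev P W (fun x => f x (v c)) ω|}
      ≤ ENNReal.ofReal (2 * Real.exp (-((p + 1) * Real.log n))) := fun c hc => by
    have hvc := norm_grid_le hn0 hM hc
    -- With `l = h³ r` the exponent is `n h³ r² (C - (C + p + 1)) = -(p + 1) log n`, and the
    -- condition `2 K l ≤ 1` is `2 C h r ≤ 1`.
    have := measure_le_abs_empDev_le hW hind (by lia) (hf (v c)) (K := C / h ^ 2) (S := C / h ^ 3)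
      (l := h ^ 3 * r) (hb.mono fun x hx => hx _ hvc) (hv _ hvc) (by positivity)
      (le_trans (le_of_eq (by field_simp)) hr2) ((C + p + 1) * r)
    refine this.trans (ENNReal.ofReal_le_ofReal (le_of_eq ?_))
    rw [← hn, ← hrn]
    congr 2
    field_simp
    ring
  have hint : ∀ u, ‖u‖ ≤ M → Integrable (fun x => f x u) P := fun u hu =>
    integrable_of_ae_abs_le (hf u) (hb.mono fun x hx => hx u hu)
  have hsub : ∀ᵐ ω ∂μ, ω ∈ {ω | ∃ u, ‖u‖ ≤ M ∧
        (C + p + 1 + 2 * C * M) * r < |empDev P W (fun x => f x u) ω|} →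
      ω ∈ ⋃ c ∈ G, {ω | (C + p + 1) * r ≤ |empDev P W (fun x => f x (v c)) ω|} := by
    filter_upwards [ae_forall_of_hasLaw hW hl] with ω hω
    rintro ⟨u, hu, hgt⟩
    obtain ⟨c, hc, hcu⟩ := exists_grid_near hn0 hM hu
    have hvc := norm_grid_le hn0 hM hc
    simp only [Set.mem_iUnion]
    refine ⟨c, hc, ?_⟩
    have hK : C / h ^ 3 * ‖u - v c‖ ≤ C / h ^ 3 * (M / n) :=
      mul_le_mul_of_nonneg_left hcu (by positivity)
    have h1 := abs_empDev_sub_le (W := W) (ω := ω) (hint u hu) (hint _ hvc)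
      (hl.mono fun x hx => (hx u (v c) hu hvc).trans hK)
      (fun i => (hω i u (v c) hu hvc).trans hK) (by lia)
    -- The discretisation error is negligible: `1 / (n h³) ≤ r² ≤ r`, as `log n ≥ 1` for `n ≥ 3` and
    -- `r ≤ 1`.
    have h2 : C / h ^ 3 * (M / n) ≤ C * M * r := by
      have h3 : 1 / (n * h ^ 3) ≤ r := calc
        1 / (n * h ^ 3) ≤ Real.log n / (n * h ^ 3) := by gcongr
        _ = r ^ 2 := hrsq.symm
        _ ≤ r := by nlinarith
      calc C / h ^ 3 * (M / n) = C * M * (1 / (n * h ^ 3)) := by field_simp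
        _ ≤ C * M * r := by gcongr
    rw [Set.mem_ofPred_eq]
    have h4 := abs_sub_abs_le_abs_sub (empDev P W (fun x => f x u) ω)
      (empDev P W (fun x => f x (v c)) ω)
    nlinarith
  refine (measure_mono_ae hsub).trans ((measure_biUnion_finset_le _ _).trans
    ((Finset.sum_le_sum hpt).trans ?_))
  rw [Finset.sum_const, nsmul_eq_mul, ← ENNReal.ofReal_natCast,
    ← ENNReal.ofReal_mul (by positivity)]
  refine ENNReal.ofReal_le_ofReal ?_
  have h5 : Real.exp (-((p + 1) * Real.log n)) = ((n : ℝ) ^ (p + 1))⁻¹ := by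
    rw [Real.exp_neg, ← Real.exp_log (show (0 : ℝ) < n ^ (p + 1) by positivity), Real.log_pow]
    push_cast
    rfl
  rw [h5]
  -- At most `(3 n)^p` grid points, each failing with probability at most `2 n^(-(p + 1))`.
  calc (G.card : ℝ) * (2 * ((n : ℝ) ^ (p + 1))⁻¹)
      ≤ (3 * n) ^ p * (2 * ((n : ℝ) ^ (p + 1))⁻¹) := by gcongr
    _ = 2 * 3 ^ p / n := by
        rw [mul_pow, pow_succ]
        field_simp

end EmpiricalProcess

/-! ### The summands of the Hessian and of the Newton error -/

section Terms

variable {p : ℕ}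

/-- The inner product of `z` with the vector with coordinates `u`. -/
noncomputable def dot (z : Vec p) (u : Fin p → ℝ) : ℝ := inner ℝ z (WithLp.toLp 2 u)

theorem dot_eq_sum (z : Vec p) (u : Fin p → ℝ) : dot z u = ∑ j, z j * u j := by
  simp [dot, PiLp.inner_apply, mul_comm]

theorem dot_sub (z : Vec p) (u v : Fin p → ℝ) : dot z (u - v) = dot z u - dot z v := by
  simp [dot_eq_sum, mul_sub]

@[simp]
theorem dot_zero (z : Vec p) : dot z 0 = 0 := by
  simp [dot_eq_sum]

theorem abs_dot_le {z : Vec p} {b : ℝ} (hz : ∀ j, |z j| ≤ b) (u : Fin p → ℝ) :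
    |dot z u| ≤ p * b * ‖u‖ := by
  rw [dot_eq_sum]
  refine (Finset.abs_sum_le_sum_abs _ _).trans
    ((Finset.sum_le_card_nsmul _ _ (b * ‖u‖) fun j _ => ?_).trans (le_of_eq ?_))
  · rw [abs_mul]
    exact mul_le_mul (hz j) (norm_le_pi_norm u j) (abs_nonneg _) ((abs_nonneg _).trans (hz j))
  · simp [mul_assoc]

@[fun_prop]
theorem measurable_dot (u : Fin p → ℝ) : Measurable fun z : Vec p => dot z u := by
  unfold dot
  fun_prop

/-- The contribution of one observation to the entry `(i, j)` of the Hessian at a point where the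
index is shifted by `a`. -/
noncomputable def hessTerm (βs : Vec p) (H : ℝ → ℝ) (h : ℝ) (i j : Fin p) (w : Triple p) (a : ℝ) :
    ℝ :=
  -response βs w * (covZ w i * covZ w j / h ^ 2 * deriv (deriv H) ((zeta βs w + a) / h))

/-- The contribution of one observation to the coordinate `i` of "Hessian times increment minus
gradient" at a point where the index is shifted by `a`. -/
noncomputable def newtonTerm (βs : Vec p) (H : ℝ → ℝ) (h : ℝ) (i : Fin p) (w : Triple p) (a : ℝ) :
    ℝ :=
  -response βs w * (covZ w i / h *
    (a / h * deriv (deriv H) ((zeta βs w + a) / h) - deriv H ((zeta βs w + a) / h)))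

variable {βs : Vec p} {H : ℝ → ℝ} {α : ℕ} {B b h : ℝ} {i j : Fin p} {w : Triple p}

theorem one_le_abs_div {t a r : ℝ} (hh : 0 < h) (hr : h + |a| ≤ r) (ht : t ∉ Set.Ioo (-r) r) :
    1 ≤ |(t + a) / h| := by
  rw [abs_div, abs_of_pos hh, le_div_iff₀ hh, one_mul]
  have h1 : r ≤ |t| := by
    by_contra hlt
    exact ht (abs_lt.1 (not_le.1 hlt))
  have h2 := abs_sub_abs_le_abs_sub t (-a)
  rw [abs_neg, sub_neg_eq_add] at h2
  linarith

theorem hessTerm_eq_zero (hH : IsSmoother H α) (hh : 0 < h) {a r : ℝ} (hr : h + |a| ≤ r)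
    (hw : zeta βs w ∉ Set.Ioo (-r) r) : hessTerm βs H h i j w a = 0 := by
  rw [hessTerm, hH.deriv_deriv_eq_zero (one_le_abs_div hh hr hw)]
  simp

theorem newtonTerm_eq_zero (hH : IsSmoother H α) (hh : 0 < h) {a r : ℝ} (hr : h + |a| ≤ r)
    (hw : zeta βs w ∉ Set.Ioo (-r) r) : newtonTerm βs H h i w a = 0 := by
  rw [newtonTerm, hH.deriv_deriv_eq_zero (one_le_abs_div hh hr hw),
    hH.deriv_eq_zero (one_le_abs_div hh hr hw)]
  simp

theorem abs_neg_response_mul (x : ℝ) : |-response βs w * x| = |x| := by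
  rw [abs_mul, abs_neg, abs_response, one_mul]

theorem abs_hessTerm_le (hB : SmootherBound H B) (hw : ∀ j, |covZ w j| ≤ b) (a : ℝ) :
    |hessTerm βs H h i j w a| ≤ b ^ 2 * B / h ^ 2 := by
  have hb : 0 ≤ b := (abs_nonneg _).trans (hw i)
  have h1 := mul_le_mul (hw i) (hw j) (abs_nonneg _) hb
  rw [hessTerm, abs_neg_response_mul, abs_mul, abs_div, abs_mul, abs_of_nonneg (sq_nonneg h),
    div_mul_eq_mul_div]
  have h2 := hB.deriv_deriv_le ((zeta βs w + a) / h)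
  have h3 := hB.pos.le
  gcongr
  nlinarith

theorem abs_hessTerm_sub_le (hB : SmootherBound H B) (hh : 0 < h) (hw : ∀ j, |covZ w j| ≤ b)
    (a a' : ℝ) :
    |hessTerm βs H h i j w a - hessTerm βs H h i j w a'| ≤ b ^ 2 * B / h ^ 3 * |a - a'| := by
  have hb : 0 ≤ b := (abs_nonneg _).trans (hw i)
  have h1 := mul_le_mul (hw i) (hw j) (abs_nonneg _) hb
  have h2 := hB.lipschitz ((zeta βs w + a) / h) ((zeta βs w + a') / h)
  have h3 := hB.pos.le
  have e : (zeta βs w + a) / h - (zeta βs w + a') / h = (a - a') / h := by ring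
  rw [e, abs_div, abs_of_pos hh] at h2
  rw [hessTerm, hessTerm, ← mul_sub, abs_neg_response_mul, ← mul_sub, abs_mul, abs_div, abs_mul,
    abs_of_nonneg (sq_nonneg h)]
  calc |covZ w i| * |covZ w j| / h ^ 2 *
        |deriv (deriv H) ((zeta βs w + a) / h) - deriv (deriv H) ((zeta βs w + a') / h)|
      ≤ (b * b) / h ^ 2 * (B * (|a - a'| / h)) := by gcongr
    _ = b ^ 2 * B / h ^ 3 * |a - a'| := by field_simp

/-- `s ↦ s H''(x + s) - H'(x + s)` has a small Lipschitz constant near `s = 0`. -/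
theorem SmootherBound.abs_newton_sub_le (hB : SmootherBound H B)
    (hH : Differentiable ℝ (deriv H)) (x s t : ℝ) :
    |(s * deriv (deriv H) (x + s) - deriv H (x + s))
      - (t * deriv (deriv H) (x + t) - deriv H (x + t))| ≤ B * (|s| + 2 * |t|) * |s - t| := by
  -- With `H'' (x + s)` frozen, `r ↦ H' r - r H'' (x + s)` has derivative at most `B |s - t|`
  -- between `x + s` and `x + t`, and contributes `B |s - t|²`. The remaining term is `t (H'' (x +
  -- s) - H'' (x + t))`.
  have h1 := DerivsBdd.abs_sub_le_of_deriv (x := x + s) (y := x + t) (K := B * |s - t|)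
    (f := fun r => deriv H r - r * deriv (deriv H) (x + s))
    (f' := fun r => deriv (deriv H) r - 1 * deriv (deriv H) (x + s))
    (fun r _ => (hH r).hasDerivAt.sub ((hasDerivAt_id r).mul_const _)) fun r hr => by
      rw [one_mul]
      refine (hB.lipschitz _ _).trans (mul_le_mul_of_nonneg_left ?_ hB.pos.le)
      refine (Set.abs_sub_left_of_mem_uIcc hr).trans (le_of_eq ?_)
      rw [abs_sub_comm]
      congr 1
      ring
  have h2 := hB.lipschitz (x + s) (x + t)
  have h3 : |t * (deriv (deriv H) (x + s) - deriv (deriv H) (x + t))| ≤ |t| * (B * |s - t|) := by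
    rw [abs_mul]
    refine mul_le_mul_of_nonneg_left (h2.trans (le_of_eq ?_)) (abs_nonneg _)
    congr 2
    ring
  have e1 : |x + t - (x + s)| = |s - t| := by
    rw [abs_sub_comm]
    congr 1
    ring
  rw [e1] at h1
  have h4 : |s - t| ≤ |s| + |t| := abs_sub s t
  have h5 : (s * deriv (deriv H) (x + s) - deriv H (x + s))
      - (t * deriv (deriv H) (x + t) - deriv H (x + t))
      = (deriv H (x + t) - (x + t) * deriv (deriv H) (x + s)
        - (deriv H (x + s) - (x + s) * deriv (deriv H) (x + s)))
        + t * (deriv (deriv H) (x + s) - deriv (deriv H) (x + t)) := by ring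
  rw [h5]
  refine (abs_add_le _ _).trans ((add_le_add h1 h3).trans ?_)
  have h6 := mul_le_mul_of_nonneg_left h4 (mul_nonneg hB.pos.le (abs_nonneg (s - t)))
  nlinarith

/-- To first order in the shift the Hessian part and the gradient part cancel, so increments near
zero shift are quadratic in the shifts. -/
theorem abs_newtonTerm_sub_le (hB : SmootherBound H B) (hH : Differentiable ℝ (deriv H))
    (hh : 0 < h) (hw : ∀ j, |covZ w j| ≤ b) (a a' : ℝ) :
    |newtonTerm βs H h i w a - newtonTerm βs H h i w a'|
      ≤ b * B * (|a| + 2 * |a'|) * |a - a'| / h ^ 3 := by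
  have hb : 0 ≤ b := (abs_nonneg _).trans (hw i)
  have h1 := hB.abs_newton_sub_le hH (zeta βs w / h) (a / h) (a' / h)
  rw [← add_div, ← add_div, ← sub_div, abs_div, abs_div, abs_div, abs_of_pos hh] at h1
  rw [newtonTerm, newtonTerm, ← mul_sub, abs_neg_response_mul, ← mul_sub, abs_mul, abs_div,
    abs_of_pos hh]
  have h3 := hB.pos.le
  have h4 := mul_le_mul (div_le_div_of_nonneg_right (hw i) hh.le) h1 (abs_nonneg _)
    (div_nonneg hb hh.le)
  refine h4.trans (le_of_eq ?_)
  field_simp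

theorem abs_newtonTerm_zero_le (hB : SmootherBound H B) (hh : 0 < h) (hw : ∀ j, |covZ w j| ≤ b) :
    |newtonTerm βs H h i w 0| ≤ b * B / h := by
  have hb : 0 ≤ b := (abs_nonneg _).trans (hw i)
  have h2 := hB.deriv_le ((zeta βs w + 0) / h)
  have h3 := hB.pos.le
  rw [newtonTerm, abs_neg_response_mul, zero_div, zero_mul, zero_sub, abs_mul, abs_neg, abs_div,
    abs_of_pos hh, div_mul_eq_mul_div]
  gcongr
  exact hw i

variable (βs H h i j) in
@[fun_prop]
theorem measurable_hessTerm {a : Triple p → ℝ} (ha : Measurable a) :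
    Measurable fun w => hessTerm βs H h i j w (a w) := by
  have h1 : Measurable (deriv (deriv H)) := measurable_deriv _
  unfold hessTerm
  fun_prop

variable (βs H h i) in
@[fun_prop]
theorem measurable_newtonTerm {a : Triple p → ℝ} (ha : Measurable a) :
    Measurable fun w => newtonTerm βs H h i w (a w) := by
  have h1 : Measurable (deriv (deriv H)) := measurable_deriv _
  have h2 : Measurable (deriv H) := measurable_deriv _
  unfold newtonTerm
  fun_prop

end Terms

/-! ### Means of the summands -/

section Means

variable {p : ℕ} {P : Measure (Triple p)} [IsProbabilityMeasure P]
  {βs : Vec p} {ρ : Vec p → ℝ → ℝ} {H : ℝ → ℝ} {α : ℕ} {η C B b h A : ℝ} {i j : Fin p}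

theorem ae_map_covZ_abs_le (hb : ∀ᵐ w ∂P, ∀ j, |covZ w j| ≤ b) :
    ∀ᵐ z ∂(P.map covZ), ∀ j, |z j| ≤ b := by
  refine (ae_map_iff measurable_covZ.aemeasurable ?_).2 hb
  have : {z : Vec p | ∀ j, |z j| ≤ b} = ⋂ j, {z : Vec p | |z j| ≤ b} := by ext; simp
  rw [this]
  exact MeasurableSet.iInter fun j => measurableSet_le (by fun_prop) measurable_const

/-- Mean of `-Y c(Z) Φ(Z, (ζ + a(Z)) / h)` for a kernel `Φ(z, ·)` supported in `[-1, 1]`. -/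
theorem integral_neg_response_mul_kernel (hF : NoiseRegular P α) (hρ : IsCondDensity P βs ρ)
    (hloc : ∀ᵐ z ∂(P.map covZ), LocalModel P βs ρ α η C z) {c a : Vec p → ℝ}
    {Φ : Vec p → ℝ → ℝ} (hc : Measurable c) (ha : Measurable a)
    (hΦ : Measurable (Function.uncurry Φ)) (hΦ0 : ∀ z x, 1 ≤ |x| → Φ z x = 0) (hh : 0 < h)
    (haη : ∀ᵐ z ∂(P.map covZ), h + |a z| < η)
    (hint : Integrable (fun w => c (covZ w) * Φ (covZ w) ((zeta βs w + a (covZ w)) / h)) P) :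
    Integrable (fun z => c z * (h * ∫ s in (-1 : ℝ)..1,
      (2 * noiseCDF P z (-(h * s - a z)) - 1) * ρ z (h * s - a z) * Φ z s)) (P.map covZ) ∧
    ∫ w, -response βs w * (c (covZ w) * Φ (covZ w) ((zeta βs w + a (covZ w)) / h)) ∂P
      = ∫ z, c z * (h * ∫ s in (-1 : ℝ)..1,
          (2 * noiseCDF P z (-(h * s - a z)) - 1) * ρ z (h * s - a z) * Φ z s) ∂(P.map covZ) := by
  have h1 := integral_neg_response_mul hF hρ hloc
    (φ := fun z t => c z * Φ z ((t + a z) / h)) ?_ hint ?_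
  · have h2 : ∀ z, ∫ t, (2 * noiseCDF P z (-t) - 1) * ρ z t * (c z * Φ z ((t + a z) / h))
        = c z * (h * ∫ s in (-1 : ℝ)..1,
          (2 * noiseCDF P z (-(h * s - a z)) - 1) * ρ z (h * s - a z) * Φ z s) := fun z => by
      rw [← integral_mul_comp_div (fun t => (2 * noiseCDF P z (-t) - 1) * ρ z t) (Φ z) (hΦ0 z) hh,
        ← integral_const_mul]
      congr 1
      ext t
      ring
    simpa only [h2] using h1
  · exact (hc.comp measurable_fst).mul
      (hΦ.comp (measurable_fst.prodMk
        ((measurable_snd.add (ha.comp measurable_fst)).div_const h)))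
  · filter_upwards [haη] with z hz t ht
    rw [hΦ0 z _ (one_le_abs_div hh hz.le ht), mul_zero]

/-- Conditionally on `Z` this is `abs_integral_newton_le` for the drift, which vanishes at `0`
because `F(0) = 1/2`. -/
theorem abs_integral_newtonTerm_le (hH : IsSmoother H α) (hB : SmootherBound H B)
    (hF : NoiseRegular P α) (hρ : IsCondDensity P βs ρ) (hC : 0 ≤ C)
    (hloc : ∀ᵐ z ∂(P.map covZ), LocalModel P βs ρ α η C z)
    (hb : ∀ᵐ w ∂P, ∀ j, |covZ w j| ≤ b) (hb0 : 0 ≤ b) (hh : 0 < h) (hA : h + A < η)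
    {a : Vec p → ℝ} (ha : Measurable a) (haA : ∀ᵐ z ∂(P.map covZ), |a z| ≤ A) :
    |∫ w, newtonTerm βs H h i w (a (covZ w)) ∂P| ≤ b * (2 * B * C * (A ^ 2 + h ^ α)) := by
  have m1 : Measurable (deriv (deriv H)) := measurable_deriv _
  have m2 : Measurable (deriv H) := measurable_deriv _
  have hB0 := hB.pos.le
  have hi : Integrable (fun w => covZ w i / h * (a (covZ w) / h *
      deriv (deriv H) ((zeta βs w + a (covZ w)) / h)
        - deriv H ((zeta βs w + a (covZ w)) / h))) P := by
    refine integrable_of_ae_abs_le (K := b / h * (A / h * B + B))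
      (Measurable.mul (by fun_prop) (by fun_prop)) ?_
    filter_upwards [hb, ae_of_ae_map measurable_covZ.aemeasurable haA] with w hw hwA
    have hA0 : 0 ≤ A := (abs_nonneg _).trans hwA
    rw [abs_mul, abs_div, abs_of_pos hh]
    refine mul_le_mul (div_le_div_of_nonneg_right (hw i) hh.le) ?_ (abs_nonneg _) (by positivity)
    refine (abs_sub _ _).trans (add_le_add ?_ (hB.deriv_le _))
    rw [abs_mul, abs_div, abs_of_pos hh]
    exact mul_le_mul (div_le_div_of_nonneg_right hwA hh.le) (hB.deriv_deriv_le _) (abs_nonneg _)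
      (by positivity)
  have key := (integral_neg_response_mul_kernel hF hρ hloc (c := fun z => z i / h) (a := a)
    (Φ := fun z x => a z / h * deriv (deriv H) x - deriv H x) (h := h) (by fun_prop) ha
    (Measurable.sub (((ha.comp measurable_fst).div_const h).mul (m1.comp measurable_snd))
      (m2.comp measurable_snd))
    (fun z x hx => by rw [hH.deriv_deriv_eq_zero hx, hH.deriv_eq_zero hx]; simp) hh
    (haA.mono fun z hz => by linarith) hi).2
  simp only [newtonTerm]
  rw [key]
  refine abs_integral_le_of_ae ?_
  filter_upwards [hloc, ae_map_covZ_abs_le hb, haA] with z hz hzb hzA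
  have h1 := abs_integral_newton_le hH hB hC hz.drift_derivs (by rw [neg_zero, hz.cdf_zero]; ring)
    hh (a := a z) (by linarith)
  have h2 : a z ^ 2 ≤ A ^ 2 := by
    rw [← sq_abs]
    exact pow_le_pow_left₀ (abs_nonneg _) hzA 2
  rw [← mul_assoc, div_mul_cancel₀ _ hh.ne', abs_mul]
  refine mul_le_mul (hzb i) (h1.trans ?_) (abs_nonneg _) hb0
  gcongr

theorem integrable_popHess (hα : 2 ≤ α)
    (hρ : IsCondDensity P βs ρ) (hη : 0 < η)
    (hloc : ∀ᵐ z ∂(P.map covZ), LocalModel P βs ρ α η C z)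
    (hb : ∀ᵐ w ∂P, ∀ j, |covZ w j| ≤ b) (hb0 : 0 ≤ b) (hC : 0 ≤ C) :
    Integrable (fun z : Vec p => ρ z 0 * deriv (noiseCDF P z) 0 * (z i * z j)) (P.map covZ) := by
  have hmF : ∀ t, Measurable fun z : Vec p => noiseCDF P z t := fun t =>
    (Kernel.measurable_coe _ measurableSet_Iic).ennreal_toReal
  have hmd : AEMeasurable (fun z => deriv (noiseCDF P z) 0) (P.map covZ) := by
    -- Measurability of `F'(0 | z)` in `z`: it is a limit of difference quotients along `1 / (n +
    -- 1)`.
    refine aemeasurable_of_tendsto_metrizable_ae (u := atTop)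
      (f := fun (n : ℕ) z => (1 / ((n : ℝ) + 1))⁻¹ •
        (noiseCDF P z (0 + 1 / ((n : ℝ) + 1)) - noiseCDF P z 0)) (fun n => ?_) ?_
    · simp only [smul_eq_mul]
      exact (((hmF _).sub (hmF _)).const_mul _).aemeasurable
    · filter_upwards [hloc] with z hz
      have h1 := hasDerivAt_iff_tendsto_slope_zero.1 hz.cdf_differentiableAt.hasDerivAt
      refine h1.comp (tendsto_nhdsWithin_iff.2 ⟨tendsto_one_div_add_atTop_nhds_zero_nat, ?_⟩)
      exact Eventually.of_forall fun n => by
        have : (0 : ℝ) < 1 / ((n : ℝ) + 1) := by positivity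
        exact this.ne'
  have hmρ : Measurable fun z => ρ z 0 := hρ.measurable.comp measurable_prodMk_right
  refine Integrable.of_bound (C := C * (b * b)) ?_ ?_
  · exact ((hmρ.aemeasurable.mul hmd).mul
      (Measurable.aemeasurable (by fun_prop))).aestronglyMeasurable
  · filter_upwards [hloc, ae_map_covZ_abs_le hb] with z hz hzb
    have h0 : (0 : ℝ) ∈ Set.Ioo (-η) η := ⟨by linarith, hη⟩
    obtain ⟨g', hg', h2⟩ := (hz.drift_derivs.of_le hα).2
    have h3 := h2.bound 0 h0
    -- The derivative of the drift at `0` is `-2 ρ(0) F'(0)`, so the bound on the drift's derivative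
    -- also bounds the integrand.
    rw [(hg' 0 h0).unique hz.drift_deriv, abs_neg, abs_mul, abs_two] at h3
    rw [Real.norm_eq_abs, abs_mul, abs_mul (z i)]
    have h4 : |ρ z 0 * deriv (noiseCDF P z) 0| ≤ C := by
      have := abs_nonneg (ρ z 0 * deriv (noiseCDF P z) 0)
      linarith
    have h5 := mul_le_mul (hzb i) (hzb j) (abs_nonneg _) hb0
    exact mul_le_mul h4 h5 (by positivity) hC

theorem abs_integral_hessTerm_sub_le (hH : IsSmoother H α) (hB : SmootherBound H B)
    (hF : NoiseRegular P α) (hρ : IsCondDensity P βs ρ) (hC : 0 ≤ C) (hη : 0 < η)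
    (hloc : ∀ᵐ z ∂(P.map covZ), LocalModel P βs ρ α η C z)
    (hb : ∀ᵐ w ∂P, ∀ j, |covZ w j| ≤ b) (hb0 : 0 ≤ b) (hh : 0 < h) (hA : h + A < η)
    {a : Vec p → ℝ} (ha : Measurable a) (haA : ∀ᵐ z ∂(P.map covZ), |a z| ≤ A) :
    |∫ w, hessTerm βs H h i j w (a (covZ w)) ∂P - popHess P ρ i j|
      ≤ b * b * (2 * B * C * (h + A)) := by
  have m1 : Measurable (deriv (deriv H)) := measurable_deriv _
  have hB0 := hB.pos.le
  have hi : Integrable (fun w => covZ w i * covZ w j / h ^ 2 *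
      deriv (deriv H) ((zeta βs w + a (covZ w)) / h)) P := by
    refine integrable_of_ae_abs_le (K := b * b / h ^ 2 * B)
      (Measurable.mul (by fun_prop) (by fun_prop)) ?_
    filter_upwards [hb] with w hw
    have h5 := mul_le_mul (hw i) (hw j) (abs_nonneg _) hb0
    rw [abs_mul, abs_div, abs_mul (covZ w i), abs_of_nonneg (sq_nonneg h)]
    exact mul_le_mul (div_le_div_of_nonneg_right h5 (sq_nonneg h)) (hB.deriv_deriv_le _)
      (abs_nonneg _) (by positivity)
  obtain ⟨ki, key⟩ := integral_neg_response_mul_kernel hF hρ hloc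
    (c := fun z => z i * z j / h ^ 2) (a := a)
    (Φ := fun _ x => deriv (deriv H) x) (h := h) (by fun_prop) ha
    (m1.comp measurable_snd)
    (fun z x hx => hH.deriv_deriv_eq_zero hx) hh
    (haA.mono fun z hz => by linarith) hi
  have hpi := (integrable_popHess (i := i) (j := j) hH.two_le hρ hη hloc hb hb0 hC).const_mul 2
  have hpop : popHess P ρ i j
      = ∫ z : Vec p, 2 * (ρ z 0 * deriv (noiseCDF P z) 0 * (z i * z j)) ∂(P.map covZ) := by
    rw [integral_map measurable_covZ.aemeasurable hpi.aestronglyMeasurable, integral_const_mul]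
    rfl
  simp only [hessTerm]
  rw [key, hpop, ← integral_sub ki hpi]
  refine abs_integral_le_of_ae ?_
  filter_upwards [hloc, ae_map_covZ_abs_le hb, haA] with z hz hzb hzA
  have h0 : (0 : ℝ) ∈ Set.Ioo (-η) η := ⟨by linarith, hη⟩
  obtain ⟨g', hg', h2⟩ := (hz.drift_derivs.of_le hH.two_le).2
  have h3 := abs_integral_hess_le hH hB hC hg' h2 hh (a := a z) (by linarith)
  rw [(hg' 0 h0).unique hz.drift_deriv] at h3
  have e : ∀ I : ℝ, z i * z j / h ^ 2 * (h * I)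
      - 2 * (ρ z 0 * deriv (noiseCDF P z) 0 * (z i * z j))
      = z i * z j * (h⁻¹ * I + -(2 * (ρ z 0 * deriv (noiseCDF P z) 0))) := fun I => by
    field_simp
    ring
  rw [e, abs_mul, abs_mul]
  have h5 := mul_le_mul (hzb i) (hzb j) (abs_nonneg _) hb0
  refine mul_le_mul h5 (h3.trans ?_) (abs_nonneg _) (by positivity)
  gcongr

end Means

/-! ### Envelope, variance and Lipschitz bounds -/

section Classes

variable {T : Type*} [MeasurableSpace T]

/-- A parametric class of functions with envelope `K / h ^ 2`, second moments `K / h ^ 3` and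
Lipschitz constant `K / h ^ 3` over the cube of half-width `M`. -/
structure ClassBound {p : ℕ} (P : Measure T) (M K h : ℝ) (f : T → (Fin p → ℝ) → ℝ) : Prop where
  measurable : ∀ u, Measurable fun x => f x u
  envelope : ∀ᵐ x ∂P, ∀ u, ‖u‖ ≤ M → |f x u| ≤ K / h ^ 2
  second_moment : ∀ u, ‖u‖ ≤ M → ∫ x, f x u ^ 2 ∂P ≤ K / h ^ 3
  lipschitz : ∀ᵐ x ∂P, ∀ u v, ‖u‖ ≤ M → ‖v‖ ≤ M → |f x u - f x v| ≤ K / h ^ 3 * ‖u - v‖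

variable {p : ℕ} {P : Measure (Triple p)} [IsProbabilityMeasure P]
  {βs : Vec p} {ρ : Vec p → ℝ → ℝ} {H : ℝ → ℝ} {α : ℕ} {η C B b D M : ℝ}

/-- From envelope, support and Lipschitz constant to the bounds of the class. -/
theorem ClassBound.of_support (hloc : ∀ᵐ z ∂(P.map covZ), LocalModel P βs ρ α η C z) (hC : 0 ≤ C)
    {K₁ K₂ S h : ℝ} (hK₁ : 0 ≤ K₁) (hK₂ : 0 ≤ K₂) (hS : 0 ≤ S) (hh : 0 < h) (hη : S * h ≤ η)
    {f : Triple p → (Fin p → ℝ) → ℝ} (hm : ∀ u, Measurable fun x => f x u)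
    (he : ∀ᵐ x ∂P, ∀ u, ‖u‖ ≤ M → |f x u| ≤ K₁ / h ^ 2)
    (hs : ∀ᵐ x ∂P, ∀ u, ‖u‖ ≤ M → zeta βs x ∉ Set.Ioo (-(S * h)) (S * h) → f x u = 0)
    (hl : ∀ᵐ x ∂P, ∀ u v, ‖u‖ ≤ M → ‖v‖ ≤ M → |f x u - f x v| ≤ K₂ / h ^ 3 * ‖u - v‖) :
    ClassBound P M (K₁ + K₁ ^ 2 * (2 * C * S) + K₂) h f := by
  have hpos : 0 ≤ K₁ ^ 2 * (2 * C * S) := by positivity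
  refine ⟨hm, ?_, fun u hu => ?_, ?_⟩
  · filter_upwards [he] with x hx u hu
    refine (hx u hu).trans ?_
    gcongr
    linarith
  · refine (integral_sq_le hloc hC (by positivity) hη (he.mono fun x hx => hx u hu)
      (hs.mono fun x hx => hx u hu)).trans ?_
    have : (K₁ / h ^ 2) ^ 2 * (2 * C * (S * h)) = K₁ ^ 2 * (2 * C * S) / h ^ 3 := by
      field_simp
    rw [this]
    gcongr
    linarith
  · filter_upwards [hl] with x hx u v hu hv
    refine (hx u v hu hv).trans ?_
    gcongr
    linarith

theorem abs_shift_le {z : Vec p} (hz : ∀ j, |z j| ≤ b) (hb : 0 ≤ b) {d : ℝ} (hd : 0 < d)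
    {u : Fin p → ℝ} (hu : ‖u‖ ≤ M) : |d * dot z u| ≤ d * (p * b * M) := by
  rw [abs_mul, abs_of_pos hd]
  exact mul_le_mul_of_nonneg_left
    ((abs_dot_le hz u).trans (mul_le_mul_of_nonneg_left hu (by positivity))) hd.le

theorem abs_shift_sub_le {z : Vec p} (hz : ∀ j, |z j| ≤ b) {d : ℝ} (hd : 0 < d)
    (u v : Fin p → ℝ) : |d * dot z u - d * dot z v| ≤ d * (p * b * ‖u - v‖) := by
  rw [← mul_sub, ← dot_sub, abs_mul, abs_of_pos hd]
  exact mul_le_mul_of_nonneg_left (abs_dot_le hz _) hd.le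

theorem exists_classBound_hessTerm (hH : IsSmoother H α) (hB : SmootherBound H B) (hC : 0 ≤ C)
    (hloc : ∀ᵐ z ∂(P.map covZ), LocalModel P βs ρ α η C z)
    (hb : ∀ᵐ w ∂P, ∀ j, |covZ w j| ≤ b) (hb0 : 0 ≤ b) (hM : 0 ≤ M) (hD : 0 ≤ D) :
    ∃ K ≥ 0, ∀ h d : ℝ, 0 < h → h ≤ 1 → 0 < d → d ≤ D * h → (1 + D * (p * b * M)) * h ≤ η →
      ∀ i j, ClassBound P M K h fun w u => hessTerm βs H h i j w (d * dot (covZ w) u) := by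
  have hB0 := hB.pos.le
  set A := p * b * M with hA
  have hA0 : 0 ≤ A := by positivity
  -- The constant of `ClassBound.of_support` with `S = 1 + D A`: for `d ≤ D h` the terms vanish
  -- unless `|ζ| < h + d A ≤ S h`.
  refine ⟨b ^ 2 * B + (b ^ 2 * B) ^ 2 * (2 * C * (1 + D * A)) + b ^ 2 * B * (D * (p * b)),
    by positivity, fun h d hh hh1 hd hdD hη i j => ?_⟩
  have hdD' : d ≤ D := hdD.trans (mul_le_of_le_one_right hD hh1)
  refine ClassBound.of_support hloc hC (by positivity) (by positivity) (by positivity) hh hη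
    (fun u => by fun_prop) ?_ ?_ ?_
  · filter_upwards [hb] with w hw u _
    exact abs_hessTerm_le hB hw _
  · filter_upwards [hb] with w hw u hu hz
    refine hessTerm_eq_zero hH hh ?_ hz
    have h1 := abs_shift_le hw hb0 hd hu
    have h2 := mul_le_mul_of_nonneg_right hdD hA0
    nlinarith
  · filter_upwards [hb] with w hw u v _ _
    refine (abs_hessTerm_sub_le hB hh hw _ _).trans ?_
    calc b ^ 2 * B / h ^ 3 * |d * dot (covZ w) u - d * dot (covZ w) v|
        ≤ b ^ 2 * B / h ^ 3 * (D * (p * b * ‖u - v‖)) := by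
          refine mul_le_mul_of_nonneg_left ((abs_shift_sub_le hw hd u v).trans ?_) (by positivity)
          gcongr
      _ = b ^ 2 * B * (D * (p * b)) / h ^ 3 * ‖u - v‖ := by ring

/-- Division by `d` leaves a class of the same order as the Hessian entries, because the increments
are quadratic in the shift and `d = O(h)`. Multiplying back gives the factor `δ` in the rate. -/
theorem exists_classBound_newtonTerm (hH : IsSmoother H α) (hB : SmootherBound H B) (hC : 0 ≤ C)
    (hloc : ∀ᵐ z ∂(P.map covZ), LocalModel P βs ρ α η C z)
    (hb : ∀ᵐ w ∂P, ∀ j, |covZ w j| ≤ b) (hb0 : 0 ≤ b) (hM : 0 ≤ M) (hD : 0 ≤ D) :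
    ∃ K ≥ 0, ∀ h d : ℝ, 0 < h → h ≤ 1 → 0 < d → d ≤ D * h → (1 + D * (p * b * M)) * h ≤ η →
      ∀ i, ClassBound P M K h fun w u =>
        d⁻¹ * (newtonTerm βs H h i w (d * dot (covZ w) u) - newtonTerm βs H h i w 0) := by
  have hB0 := hB.pos.le
  set A := p * b * M with hA
  have hA0 : 0 ≤ A := by positivity
  refine ⟨b * B * A ^ 2 * D + (b * B * A ^ 2 * D) ^ 2 * (2 * C * (1 + D * A))
    + b * B * (3 * A) * (p * b) * D, by positivity, fun h d hh hh1 hd hdD hη i => ?_⟩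
  have hdD' : d ≤ D := hdD.trans (mul_le_of_le_one_right hD hh1)
  refine ClassBound.of_support hloc hC (by positivity) (by positivity) (by positivity) hh hη
    (fun u => by fun_prop) ?_ ?_ ?_
  · filter_upwards [hb] with w hw u hu
    have h1 := abs_shift_le hw hb0 hd hu
    have h2 := abs_newtonTerm_sub_le (βs := βs) (i := i) hB hH.differentiable_deriv hh hw
      (d * dot (covZ w) u) 0
    rw [abs_zero, mul_zero, add_zero, sub_zero] at h2
    rw [abs_mul, abs_of_pos (inv_pos.2 hd), inv_mul_le_iff₀ hd]
    refine h2.trans ?_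
    calc b * B * |d * dot (covZ w) u| * |d * dot (covZ w) u| / h ^ 3
        ≤ b * B * (d * A) * (d * A) / h ^ 3 := by gcongr
      _ = d * (b * B * A ^ 2 * d / h ^ 3) := by ring
      _ ≤ d * (b * B * A ^ 2 * (D * h) / h ^ 3) := by gcongr
      _ = d * (b * B * A ^ 2 * D / h ^ 2) := by field_simp
  · filter_upwards [hb] with w hw u hu hz
    have h1 := abs_shift_le hw hb0 hd hu
    have h2 := mul_le_mul_of_nonneg_right hdD hA0
    have h3 : 0 ≤ D * A * h := by positivity
    rw [newtonTerm_eq_zero hH hh (by nlinarith) hz,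
      newtonTerm_eq_zero hH hh (by rw [abs_zero]; nlinarith) hz]
    simp
  · filter_upwards [hb] with w hw u v hu hv
    have h1 := abs_shift_le hw hb0 hd hu
    have h1' := abs_shift_le hw hb0 hd hv
    have h2 := abs_newtonTerm_sub_le (βs := βs) (i := i) hB hH.differentiable_deriv hh hw
      (d * dot (covZ w) u) (d * dot (covZ w) v)
    rw [← mul_sub, sub_sub_sub_cancel_right, abs_mul, abs_of_pos (inv_pos.2 hd),
      inv_mul_le_iff₀ hd]
    refine h2.trans ?_
    calc b * B * (|d * dot (covZ w) u| + 2 * |d * dot (covZ w) v|)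
          * |d * dot (covZ w) u - d * dot (covZ w) v| / h ^ 3
        ≤ b * B * (d * A + 2 * (d * A)) * (d * (p * b * ‖u - v‖)) / h ^ 3 := by
          have := abs_shift_sub_le hw hd u v
          gcongr
      _ = d * (b * B * (3 * A) * (p * b) * d / h ^ 3 * ‖u - v‖) := by ring
      _ ≤ d * (b * B * (3 * A) * (p * b) * D / h ^ 3 * ‖u - v‖) := by gcongr

end Classes

/-! ### The Newton step as an empirical mean -/

section Algebra

variable {p : ℕ} {βs : Vec p} {H : ℝ → ℝ} {L m : ℕ}

theorem covX_add_inner (w : Triple p) (d : ℝ) (u : Fin p → ℝ) :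
    covX w + inner ℝ (covZ w) (βs + d • WithLp.toLp 2 u) = zeta βs w + d * dot (covZ w) u := by
  rw [inner_add_right, inner_smul_right, zeta, dot, add_assoc]

theorem avgHess_eq (h d : ℝ) (D : Fin L → Fin m → Triple p) (u : Fin p → ℝ) (i j : Fin p) :
    avgHess H h (fun l q => observe βs (D l q)) (βs + d • WithLp.toLp 2 u) i j
      = ((L * m : ℕ) : ℝ)⁻¹ * ∑ q : Fin L × Fin m,
        hessTerm βs H h i j (D q.1 q.2) (d * dot (covZ (D q.1 q.2)) u) := by
  simp only [avgHess, localHess, observe, covX_add_inner, Matrix.smul_apply, Matrix.sum_apply,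
    Matrix.vecMulVec_apply, smul_eq_mul, Fintype.sum_prod_type, hessTerm, Finset.mul_sum]
  refine Finset.sum_congr rfl fun l _ => Finset.sum_congr rfl fun q _ => ?_
  push_cast
  ring

theorem avgGrad_eq (h d : ℝ) (D : Fin L → Fin m → Triple p) (u : Fin p → ℝ) (i : Fin p) :
    avgGrad H h (fun l q => observe βs (D l q)) (βs + d • WithLp.toLp 2 u) i
      = ((L * m : ℕ) : ℝ)⁻¹ * ∑ q : Fin L × Fin m,
        -response βs (D q.1 q.2) * (covZ (D q.1 q.2) i / h *
          deriv H ((zeta βs (D q.1 q.2) + d * dot (covZ (D q.1 q.2)) u) / h)) := by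
  simp only [avgGrad, localGrad, observe, covX_add_inner, PiLp.smul_apply, WithLp.ofLp_sum,
    Finset.sum_apply, WithLp.ofLp_smul, Pi.smul_apply,
    smul_eq_mul, Fintype.sum_prod_type, Finset.mul_sum]
  refine Finset.sum_congr rfl fun l _ => Finset.sum_congr rfl fun q _ => ?_
  push_cast
  ring

/-- Applying the rank-one matrix `z zᵀ` to `d u` gives `(d zᵀu) z`, so each observation enters only
through its own index shift. -/
theorem avgHess_mulVec_sub_avgGrad {h : ℝ} (d : ℝ) (D : Fin L → Fin m → Triple p)
    (u : Fin p → ℝ) (i : Fin p) :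
    Matrix.mulVec (avgHess H h (fun l q => observe βs (D l q)) (βs + d • WithLp.toLp 2 u))
        (d • u) i
      - avgGrad H h (fun l q => observe βs (D l q)) (βs + d • WithLp.toLp 2 u) i
      = ((L * m : ℕ) : ℝ)⁻¹ * ∑ q : Fin L × Fin m,
        newtonTerm βs H h i (D q.1 q.2) (d * dot (covZ (D q.1 q.2)) u) := by
  rw [avgGrad_eq, Matrix.mulVec, dotProduct]
  simp only [avgHess_eq, Pi.smul_apply, smul_eq_mul]
  have e : ∀ w : Triple p, newtonTerm βs H h i w (d * dot (covZ w) u)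
      = ∑ j, hessTerm βs H h i j w (d * dot (covZ w) u) * (d * u j)
        - -response βs w * (covZ w i / h * deriv H ((zeta βs w + d * dot (covZ w) u) / h)) :=
    fun w => by
      have e1 : ∑ j, hessTerm βs H h i j w (d * dot (covZ w) u) * (d * u j)
          = -response βs w * (covZ w i / h ^ 2 *
            deriv (deriv H) ((zeta βs w + d * dot (covZ w) u) / h)) * (d * dot (covZ w) u) := by
        rw [dot_eq_sum, Finset.mul_sum, Finset.mul_sum]
        refine Finset.sum_congr rfl fun j _ => ?_
        rw [hessTerm]
        ring
      rw [e1, newtonTerm]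
      ring
  simp only [e, Finset.sum_sub_distrib, mul_sub]
  congr 1
  rw [Finset.sum_comm, Finset.mul_sum]
  refine Finset.sum_congr rfl fun j _ => ?_
  rw [Finset.mul_sum, Finset.mul_sum, Finset.sum_mul]
  exact Finset.sum_congr rfl fun q _ => by ring

/-- Insert `Q⁻¹ Q = 1` in front of the increment `d u`, where `Q` is the averaged Hessian. -/
theorem newtonStep_sub {h : ℝ} (d : ℝ) (D : Fin L → Fin m → ℝ × ℝ × Vec p) (u : Fin p → ℝ)
    (hunit : IsUnit (avgHess H h D (βs + d • WithLp.toLp 2 u))) :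
    newtonStep H h D (βs + d • WithLp.toLp 2 u) - βs
      = WithLp.toLp 2 (Matrix.mulVec (avgHess H h D (βs + d • WithLp.toLp 2 u))⁻¹
        (Matrix.mulVec (avgHess H h D (βs + d • WithLp.toLp 2 u)) (d • u)
          - (avgGrad H h D (βs + d • WithLp.toLp 2 u)).ofLp)) := by
  rw [Matrix.mulVec_sub, Matrix.mulVec_mulVec,
    Matrix.nonsing_inv_mul _ ((Matrix.isUnit_iff_isUnit_det _).1 hunit), Matrix.one_mulVec,
    newtonStep, WithLp.toLp_sub, WithLp.toLp_smul]
  abel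

/-- The inverse is locally bounded near an invertible matrix. -/
theorem exists_forall_isUnit_of_close {V : Matrix (Fin p) (Fin p) ℝ} (hV : IsUnit V) :
    ∃ e > 0, ∃ K ≥ 0, ∀ Q : Matrix (Fin p) (Fin p) ℝ, (∀ i j, |Q i j - V i j| < e) →
      IsUnit Q ∧ ∀ i j, |Q⁻¹ i j| ≤ K := by
  have hdet : V.det ≠ 0 := ((Matrix.isUnit_iff_isUnit_det V).1 hV).ne_zero
  have hc : ContinuousAt (fun Q : Matrix (Fin p) (Fin p) ℝ => Q⁻¹) V := by
    refine continuousAt_matrix_inv V ?_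
    rw [Ring.inverse_eq_inv']
    exact continuousAt_inv₀ hdet
  set K := ∑ i, ∑ j, |V⁻¹ i j| with hK
  have h1 : ∀ᶠ Q in 𝓝 V, IsUnit Q := by
    filter_upwards [(Continuous.matrix_det continuous_id).continuousAt.eventually_ne hdet]
      with Q hQ
    exact (Matrix.isUnit_iff_isUnit_det Q).2 (isUnit_iff_ne_zero.2 hQ)
  have h2 : ∀ᶠ Q in 𝓝 V, ∀ i j, |Q⁻¹ i j| ≤ K + 1 := by
    rw [eventually_all]
    intro i
    rw [eventually_all]
    intro j
    have h3 : ContinuousAt (fun Q : Matrix (Fin p) (Fin p) ℝ => |Q⁻¹ i j|) V :=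
      ((continuous_id.matrix_elem i j).continuousAt.comp hc).abs
    have h4 : |V⁻¹ i j| < K + 1 := by
      have h5 : |V⁻¹ i j| ≤ ∑ j, |V⁻¹ i j| :=
        Finset.single_le_sum (f := fun j => |V⁻¹ i j|) (fun _ _ => abs_nonneg _)
          (Finset.mem_univ j)
      have h6 : ∑ j, |V⁻¹ i j| ≤ K :=
        Finset.single_le_sum (f := fun i => ∑ j, |V⁻¹ i j|)
          (fun _ _ => Finset.sum_nonneg fun _ _ => abs_nonneg _) (Finset.mem_univ i)
      linarith
    filter_upwards [h3.eventually (gt_mem_nhds h4)] with Q hQ using hQ.le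
  -- Read in the sup metric of the entries, in which neighbourhoods are entrywise.
  have h7 : ∀ᶠ Q : Fin p → Fin p → ℝ in 𝓝 V, IsUnit (Matrix.of Q) ∧
      ∀ i j, |(Matrix.of Q)⁻¹ i j| ≤ K + 1 := h1.and h2
  obtain ⟨e, he, h8⟩ := Metric.eventually_nhds_iff.1 h7
  refine ⟨e, he, K + 1, by positivity, fun Q hQ => h8 (y := Q) ?_⟩
  exact (dist_pi_lt_iff he).2 fun i => (dist_pi_lt_iff he).2 fun j => hQ i j

end Algebra

/-! ### Stochastic rates along the sequence of samples -/

section Rates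

variable {p : ℕ} {T Ω κ : Type*} [MeasurableSpace T] [MeasurableSpace Ω] [Fintype κ]
  {P : Measure T} [IsProbabilityMeasure P] {μ : Measure Ω} [IsProbabilityMeasure μ]
  {L m : ℕ → ℕ} {W : ∀ k, Fin (L k) → Fin (m k) → Ω → T} {h : ℕ → ℝ}

/-- Union bound for finitely many events. -/
theorem measure_iUnion_le_of_forall {s : κ → Set Ω} {e ε : ℝ} (hs : ∀ c, μ (s c) ≤ ENNReal.ofReal e)
    (hε : Fintype.card κ * e ≤ ε) : μ (⋃ c, s c) ≤ ENNReal.ofReal ε := by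
  refine (measure_iUnion_fintype_le μ s).trans ((Finset.sum_le_sum fun c _ => hs c).trans ?_)
  rw [Finset.sum_const, nsmul_eq_mul, ← ENNReal.ofReal_natCast, ← ENNReal.ofReal_mul (by positivity)]
  exact ENNReal.ofReal_le_ofReal hε

theorem card_prod_fin (L m : ℕ) : Fintype.card (Fin L × Fin m) = L * m := by simp

/-- Uniform law of large numbers with rate for classes as in `ClassBound`. -/
theorem exists_uniform_empDev_le (hn : Tendsto (fun k => L k * m k) atTop atTop)
    (hW_law : ∀ k l j, HasLaw (W k l j) P μ)
    (hW_indep : ∀ k, iIndepFun (fun i : Fin (L k) × Fin (m k) => W k i.1 i.2) μ)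
    (hh_pos : ∀ k, 0 < h k) (hh : Tendsto h atTop (𝓝 0)) {r : ℕ → ℝ}
    (hr_def : ∀ k, r k = √(Real.log ((L k * m k : ℕ) : ℝ) / (((L k * m k : ℕ) : ℝ) * h k ^ 3)))
    (hr : Tendsto r atTop (𝓝 0)) {M K : ℝ} (hM : 0 < M) (hK : 0 ≤ K)
    {f : ℕ → κ → T → (Fin p → ℝ) → ℝ}
    (hf : ∀ᶠ k in atTop, ∀ c, ClassBound P M K (h k) (f k c)) :
    ∃ A ≥ 0, ∀ ε > 0, ∀ᶠ k in atTop, μ {ω | ¬ ∀ c u, ‖u‖ ≤ M →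
      |empDev P (fun q : Fin (L k) × Fin (m k) => W k q.1 q.2) (fun x => f k c x u) ω| ≤ A * r k}
        ≤ ENNReal.ofReal ε := by
  -- The failure probability is of order `1 / n`, so one constant serves every `ε`.
  refine ⟨K + p + 1 + 2 * K * M, by positivity, fun ε hε => ?_⟩
  have h1 : ∀ᶠ k in atTop, r k ≤ 1 := hr.eventually_le_const one_pos
  have h2 : ∀ᶠ k in atTop, 2 * K * h k * r k ≤ 1 := by
    have : Tendsto (fun k => 2 * K * h k * r k) atTop (𝓝 (2 * K * 0 * 0)) :=
      (hh.const_mul (2 * K)).mul hr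
    exact this.eventually_le_const (by simp)
  have h3 : ∀ᶠ k in atTop,
      (Fintype.card κ : ℝ) * (2 * 3 ^ p / ((L k * m k : ℕ) : ℝ)) ≤ ε := by
    have : Tendsto (fun k => (Fintype.card κ : ℝ) * (2 * 3 ^ p / ((L k * m k : ℕ) : ℝ))) atTop
        (𝓝 (Fintype.card κ * 0)) :=
      ((tendsto_natCast_atTop_atTop.comp hn).const_div_atTop _).const_mul _
    exact this.eventually_le_const (by simpa using hε)
  filter_upwards [hf, h1, h2, h3, hn.eventually_ge_atTop 3] with k hfk hr1 hr2 hε' hn3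
  have hc : ∀ c, μ {ω | ∃ u, ‖u‖ ≤ M ∧ (K + p + 1 + 2 * K * M) * r k <
      |empDev P (fun q : Fin (L k) × Fin (m k) => W k q.1 q.2) (fun x => f k c x u) ω|}
      ≤ ENNReal.ofReal (2 * 3 ^ p / ((L k * m k : ℕ) : ℝ)) := fun c => by
    have := measure_exists_lt_empDev_le
      (W := fun q : Fin (L k) × Fin (m k) => W k q.1 q.2) (fun i => hW_law k i.1 i.2) (hW_indep k)
      (hfk c).measurable hM hK (hh_pos k) (hfk c).envelope (hfk c).second_moment (hfk c).lipschitz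
      (by rwa [card_prod_fin]) (by rw [card_prod_fin]; exact hr_def k) hr1 hr2
    rwa [card_prod_fin] at this
  refine (measure_mono fun ω hω => ?_).trans (measure_iUnion_le_of_forall hc hε')
  rw [Set.mem_ofPred_eq] at hω
  push Not at hω
  obtain ⟨c, u, hu, hlt⟩ := hω
  exact Set.mem_iUnion.2 ⟨c, u, hu, hlt⟩

/-- Rate of the empirical means of finitely many functions with envelope of the order `1 / h` and
second moments of the order `1 / h`. -/
theorem exists_empDev_le (hn : Tendsto (fun k => L k * m k) atTop atTop)
    (hW_law : ∀ k l j, HasLaw (W k l j) P μ)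
    (hW_indep : ∀ k, iIndepFun (fun i : Fin (L k) × Fin (m k) => W k i.1 i.2) μ)
    (hh_pos : ∀ k, 0 < h k) {S : ℝ} (hS : 0 ≤ S) {f : ℕ → κ → T → ℝ}
    (hfm : ∀ k c, Measurable (f k c)) (hfb : ∀ k c, ∃ K, ∀ᵐ x ∂P, |f k c x| ≤ K)
    (hfS : ∀ᶠ k in atTop, ∀ c, ∫ x, f k c x ^ 2 ∂P ≤ S / h k) {ε : ℝ} (hε : 0 < ε) :
    ∃ A ≥ 0, ∀ᶠ k in atTop, μ {ω | ¬ ∀ c,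
      |empDev P (fun q : Fin (L k) × Fin (m k) => W k q.1 q.2) (f k c) ω|
        ≤ A * √(1 / (((L k * m k : ℕ) : ℝ) * h k))} ≤ ENNReal.ofReal ε := by
  -- Chebyshev gives `S / A²` for each function; `A` is chosen so that all of them together fail
  -- with probability at most `ε`.
  set A := √(Fintype.card κ * (S / ε) + 1) with hA
  have hA2 : A ^ 2 = Fintype.card κ * (S / ε) + 1 := Real.sq_sqrt (by positivity)
  have hA0 : 0 < A := Real.sqrt_pos.2 (by positivity)
  refine ⟨A, hA0.le, ?_⟩
  filter_upwards [hfS, hn.eventually_ge_atTop 1] with k hfk hn1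
  have hnr : (0 : ℝ) < ((L k * m k : ℕ) : ℝ) := by exact_mod_cast hn1
  have hhk := hh_pos k
  set t := A * √(1 / (((L k * m k : ℕ) : ℝ) * h k)) with ht
  have ht0 : 0 < t := mul_pos hA0 (Real.sqrt_pos.2 (by positivity))
  have ht2 : t ^ 2 = A ^ 2 * (1 / (((L k * m k : ℕ) : ℝ) * h k)) := by
    rw [ht, mul_pow,
      Real.sq_sqrt (show (0 : ℝ) ≤ 1 / (((L k * m k : ℕ) : ℝ) * h k) by positivity)]
  have hc : ∀ c, μ {ω | t ≤ |empDev P (fun q : Fin (L k) × Fin (m k) => W k q.1 q.2) (f k c) ω|}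
      ≤ ENNReal.ofReal (S / A ^ 2) := fun c => by
    obtain ⟨K, hK⟩ := hfb k c
    have := measure_lt_abs_empDev_le_div
      (W := fun q : Fin (L k) × Fin (m k) => W k q.1 q.2) (fun i => hW_law k i.1 i.2) (hW_indep k)
      (by rw [card_prod_fin]; exact hn1) (hfm k c) hK (hfk c) ht0
    rw [card_prod_fin, ht2] at this
    refine this.trans (ENNReal.ofReal_le_ofReal (le_of_eq ?_))
    field_simp
  refine (measure_mono fun ω hω => ?_).trans (measure_iUnion_le_of_forall hc ?_)
  · rw [Set.mem_ofPred_eq] at hω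
    push Not at hω
    obtain ⟨c, hlt⟩ := hω
    exact Set.mem_iUnion.2 ⟨c, hlt.le⟩
  · rw [hA2, ← mul_div_assoc, div_le_iff₀ (by positivity), mul_add, mul_one]
    have : ε * (Fintype.card κ * (S / ε)) = Fintype.card κ * S := by field_simp
    linarith

theorem norm_toLp_le {x : Fin p → ℝ} {c : ℝ} (hc : 0 ≤ c) (hx : ∀ i, |x i| ≤ c) :
    ‖(WithLp.toLp 2 x : Vec p)‖ ≤ p * c := by
  rw [EuclideanSpace.norm_eq]
  refine Real.sqrt_le_iff.2 ⟨by positivity, ?_⟩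
  have h1 : ∑ i, ‖x i‖ ^ 2 ≤ p * c ^ 2 := by
    refine (Finset.sum_le_card_nsmul _ _ (c ^ 2) fun i _ => ?_).trans (le_of_eq (by simp))
    exact pow_le_pow_left₀ (norm_nonneg _) (hx i) 2
  have h2 : (p : ℝ) ≤ (p : ℝ) ^ 2 := by exact_mod_cast Nat.le_self_pow two_ne_zero p
  calc ∑ i, ‖x i‖ ^ 2 ≤ p * c ^ 2 := h1
    _ ≤ (p : ℝ) ^ 2 * c ^ 2 := by gcongr
    _ = (p * c) ^ 2 := by ring

theorem abs_mulVec_le {A : Matrix (Fin p) (Fin p) ℝ} {x : Fin p → ℝ} {K c : ℝ} (hK : 0 ≤ K)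
    (hA : ∀ i j, |A i j| ≤ K) (hx : ∀ i, |x i| ≤ c) (i : Fin p) :
    |Matrix.mulVec A x i| ≤ p * (K * c) := by
  rw [Matrix.mulVec, dotProduct]
  refine (Finset.abs_sum_le_sum_abs _ _).trans
    ((Finset.sum_le_card_nsmul _ _ (K * c) fun j _ => ?_).trans (le_of_eq (by simp)))
  rw [abs_mul]
  exact mul_le_mul (hA i j) (hx j) (abs_nonneg _) hK

end Rates

/-! ### Assembling the proposition -/

/-- Only subadditivity is used, so that the events need not be measurable. -/
theorem tendsto_measure_of_compl_le {Ω : Type*} [MeasurableSpace Ω] {μ : Measure Ω}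
    [IsProbabilityMeasure μ] {s : ℕ → Set Ω}
    (hs : ∀ ε > 0, ∀ᶠ k in atTop, μ (s k)ᶜ ≤ ENNReal.ofReal ε) :
    Tendsto (fun k => μ (s k)) atTop (𝓝 1) := by
  have h1 : Tendsto (fun k => μ (s k)ᶜ) atTop (𝓝 0) := by
    rw [ENNReal.tendsto_nhds_zero]
    intro e he
    rcases eq_or_ne e ⊤ with rfl | htop
    · exact Eventually.of_forall fun _ => le_top
    · have := hs e.toReal (ENNReal.toReal_pos he.ne' htop)
      rwa [ENNReal.ofReal_toReal htop] at this
  have h2 : Tendsto (fun k => 1 - μ (s k)ᶜ) atTop (𝓝 1) := by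
    simpa using ENNReal.Tendsto.sub (tendsto_const_nhds (x := (1 : ENNReal))) h1
      (Or.inl ENNReal.one_ne_top)
  refine tendsto_of_tendsto_of_tendsto_of_le_of_le h2 tendsto_const_nhds (fun k => ?_)
    fun k => prob_le_one
  rw [tsub_le_iff_right]
  calc (1 : ENNReal) = μ (s k ∪ (s k)ᶜ) := by rw [Set.union_compl_self, measure_univ]
    _ ≤ μ (s k) + μ (s k)ᶜ := measure_union_le _ _

theorem empDev_const_mul {Ω T ι : Type*} [MeasurableSpace T] [Fintype ι] (P : Measure T)
    (W : ι → Ω → T) (c : ℝ) (f : T → ℝ) (ω : Ω) :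
    empDev P W (fun x => c * f x) ω = c * empDev P W f ω := by
  rw [empDev, empDev, ← Finset.mul_sum, integral_const_mul]
  ring

theorem empDev_sub {Ω T ι : Type*} [MeasurableSpace T] [Fintype ι] {P : Measure T}
    (W : ι → Ω → T) {f g : T → ℝ} (hf : Integrable f P) (hg : Integrable g P) (ω : Ω) :
    empDev P W (fun x => f x - g x) ω = empDev P W f ω - empDev P W g ω := by
  rw [empDev, empDev, empDev, Finset.sum_sub_distrib, integral_sub hf hg]
  ring

/-- With probability close to one, the averaged Hessian is invertible and the error of the Newton
step is of the asserted order. -/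
theorem exists_newton_bound {p : ℕ}
    (P : Measure (Triple p)) [IsProbabilityMeasure P]
    (βs : Vec p) (H : ℝ → ℝ) (α : ℕ) (ρ : Vec p → ℝ → ℝ)
    (hmedian : NoiseMedianZero P) (hH : IsSmoother H α) (hρ : IsCondDensity P βs ρ)
    (hρ_reg : IndexDensityRegular P ρ α) (hF_reg : NoiseRegular P α)
    (hV : PopHessNondegenerate P ρ) (hZ : CovariatesBounded P)
    {Ω : Type*} [MeasurableSpace Ω] (μ : Measure Ω) [IsProbabilityMeasure μ]
    (L m : ℕ → ℕ) (hn : Tendsto (fun k => L k * m k) atTop atTop)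
    (W : ∀ k, Fin (L k) → Fin (m k) → Ω → Triple p)
    (hW_law : ∀ k l j, HasLaw (W k l j) P μ)
    (hW_indep : ∀ k, iIndepFun (fun i : Fin (L k) × Fin (m k) => W k i.1 i.2) μ)
    (h δ : ℕ → ℝ) (hh_pos : ∀ k, 0 < h k) (hδ_pos : ∀ k, 0 < δ k)
    (β₀ : ℕ → Ω → Vec p)
    (hβ₀ : IsBigOP μ (fun k ω => ‖β₀ k ω - βs‖) δ)
    (hδ : δ =O[atTop] h) (hh : Tendsto h atTop (𝓝 0))
    (hnh : Tendsto (fun k => Real.log ((L k * m k : ℕ) : ℝ) / (((L k * m k : ℕ) : ℝ) * h k ^ 3))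
      atTop (𝓝 0)) (ε : ℝ) (hε : 0 < ε) :
    ∃ A : ℝ, ∀ᶠ k in atTop, μ {ω | ¬ (IsUnit
        (avgHess H (h k) (fun l j => observe βs (W k l j ω)) (β₀ k ω)) ∧
      ‖newtonStep H (h k) (fun l j => observe βs (W k l j ω)) (β₀ k ω) - βs‖ ≤ A *
        (δ k ^ 2 + h k ^ α + √(1 / (((L k * m k : ℕ) : ℝ) * h k))
          + δ k * √(Real.log ((L k * m k : ℕ) : ℝ) / (((L k * m k : ℕ) : ℝ) * h k ^ 3))))}
      ≤ ENNReal.ofReal ε := by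
  obtain ⟨η, hη, C, hC, hloc⟩ := exists_localModel hH.two_le hmedian hρ hρ_reg hF_reg
  obtain ⟨B, hB⟩ := hH.exists_bound
  have hB0 := hB.pos.le
  obtain ⟨b, hb0, hb⟩ : ∃ b : ℝ, 0 ≤ b ∧ ∀ᵐ w ∂P, ∀ j, |covZ w j| ≤ b := by
    obtain ⟨b, hb⟩ := hZ
    exact ⟨max b 0, le_max_right _ _, hb.mono fun w hw j => (hw j).trans (le_max_left _ _)⟩
  obtain ⟨D, hD, hδD⟩ := hδ.exists_pos
  -- Zero is not an eigenvalue, as all eigenvalues exceed `c⁻¹ > 0`.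
  have hVunit : IsUnit (popHess P ρ) := by
    obtain ⟨c, hc, hspec⟩ := hV
    by_contra hnot
    have h1 := (hspec 0 (spectrum.zero_mem_iff ℝ |>.2 hnot)).1
    have h2 := inv_pos.2 hc
    linarith
  obtain ⟨e, he, K, hK, hclose⟩ := exists_forall_isUnit_of_close hVunit
  obtain ⟨M', hM'⟩ := hβ₀ (ε / 4) (by positivity)
  set M := max M' 1 with hM_def
  have hM : 0 < M := lt_of_lt_of_le one_pos (le_max_right _ _)
  set a := p * b * M with ha_def
  have ha0 : 0 ≤ a := by positivity
  set r : ℕ → ℝ := fun k =>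
    √(Real.log ((L k * m k : ℕ) : ℝ) / (((L k * m k : ℕ) : ℝ) * h k ^ 3)) with hr_def
  have hr : Tendsto r atTop (𝓝 0) := by
    have h1 := (Real.continuous_sqrt.tendsto 0).comp hnh
    rwa [Real.sqrt_zero] at h1
  have hδ0 : Tendsto δ atTop (𝓝 0) := hδ.trans_tendsto hh
  have hδh : ∀ᶠ k in atTop, δ k ≤ D * h k := by
    filter_upwards [hδD.bound] with k hk
    rwa [Real.norm_of_nonneg (hδ_pos k).le, Real.norm_of_nonneg (hh_pos k).le] at hk
  have hh1 : ∀ᶠ k in atTop, h k ≤ 1 := hh.eventually_le_const one_pos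
  have hhη : ∀ᶠ k in atTop, (1 + D * a) * h k ≤ η := by
    have : Tendsto (fun k => (1 + D * a) * h k) atTop (𝓝 ((1 + D * a) * 0)) := hh.const_mul _
    exact this.eventually_le_const (by simpa using hη)
  have hhη' : ∀ᶠ k in atTop, h k + δ k * a < η := by
    have : Tendsto (fun k => h k + δ k * a) atTop (𝓝 (0 + 0 * a)) := hh.add (hδ0.mul_const a)
    exact this.eventually_lt_const (by simpa using hη)
  obtain ⟨K₁, hK₁, hcl₁⟩ := exists_classBound_hessTerm hH hB hC hloc hb hb0 hM.le hD.le
  obtain ⟨K₂, hK₂, hcl₂⟩ := exists_classBound_newtonTerm hH hB hC hloc hb hb0 hM.le hD.le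
  obtain ⟨A₁, hA₁, hev₁⟩ := exists_uniform_empDev_le (p := p) (κ := Fin p × Fin p) hn hW_law
    hW_indep hh_pos hh (r := r) (fun _ => rfl) hr hM hK₁
    (f := fun k c w u => hessTerm βs H (h k) c.1 c.2 w (δ k * dot (covZ w) u)) (by
      filter_upwards [hδh, hh1, hhη] with k h1 h2 h3 c
      exact hcl₁ _ _ (hh_pos k) h2 (hδ_pos k) h1 h3 c.1 c.2)
  obtain ⟨A₂, hA₂, hev₂⟩ := exists_uniform_empDev_le (p := p) (κ := Fin p) hn hW_law
    hW_indep hh_pos hh (r := r) (fun _ => rfl) hr hM hK₂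
    (f := fun k i w u => (δ k)⁻¹ * (newtonTerm βs H (h k) i w (δ k * dot (covZ w) u)
      - newtonTerm βs H (h k) i w 0)) (by
      filter_upwards [hδh, hh1, hhη] with k h1 h2 h3 i
      exact hcl₂ _ _ (hh_pos k) h2 (hδ_pos k) h1 h3 i)
  obtain ⟨A₃, hA₃, hev₃⟩ := exists_empDev_le (κ := Fin p) hn hW_law hW_indep hh_pos
    -- Envelope `b B / h`, squared, times the probability `2 C h` of the support.
    (S := (b * B) ^ 2 * (2 * C)) (by positivity)
    (f := fun k i w => newtonTerm βs H (h k) i w 0) (fun k i => by fun_prop)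
    (fun k i => ⟨b * B / h k, hb.mono fun w hw => abs_newtonTerm_zero_le hB (hh_pos k) hw⟩) (by
      filter_upwards [hhη'] with k hk i
      have hhk := hh_pos k
      refine (integral_sq_le hloc hC hhk.le (by nlinarith [mul_nonneg (hδ_pos k).le ha0])
        (hb.mono fun w hw => abs_newtonTerm_zero_le hB hhk hw)
        (Eventually.of_forall fun w hw =>
          newtonTerm_eq_zero hH hhk (by simp) hw)).trans (le_of_eq ?_)
      field_simp) (ε := ε / 4) (by positivity)
  have hhess : ∀ᶠ k in atTop, A₁ * r k + b * b * (2 * B * C * (h k + δ k * a)) < e := by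
    have : Tendsto (fun k => A₁ * r k + b * b * (2 * B * C * (h k + δ k * a))) atTop
        (𝓝 (A₁ * 0 + b * b * (2 * B * C * (0 + 0 * a)))) :=
      (hr.const_mul _).add (((hh.add (hδ0.mul_const a)).const_mul _).const_mul _)
    exact this.eventually_lt_const (by simpa using he)
  -- The three summands belong to the increment of the deviation, to the deviation at the true
  -- parameter and to the bias. The two factors `p` below come from the norm of a vector and from
  -- the matrix product.
  set A₄ := A₂ + A₃ + b * (2 * B * C * (a ^ 2 + 1)) with hA₄
  refine ⟨p * (p * (K * A₄)), ?_⟩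
  filter_upwards [hM', hev₁ (ε / 4) (by positivity), hev₂ (ε / 4) (by positivity), hev₃, hhess,
    hδh, hh1, hhη, hhη'] with k e₀ e₁ e₂ e₃ hk_hess hkδ hk1 hkη hkη'
  have hhk := hh_pos k
  have hδk := hδ_pos k
  set R := δ k ^ 2 + h k ^ α + √(1 / (((L k * m k : ℕ) : ℝ) * h k)) + δ k * r k with hR
  have hr0 : 0 ≤ r k := Real.sqrt_nonneg _
  have hR0 : 0 ≤ R := by positivity
  have hdot : ∀ u : Fin p → ℝ, ‖u‖ ≤ M → ∀ᵐ z ∂(P.map covZ), |δ k * dot z u| ≤ δ k * a :=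
    fun u hu => (ae_map_covZ_abs_le hb).mono fun z hz => abs_shift_le hz hb0 hδk hu
  -- Four exceptional events of probability at most `ε / 4` each: a large initial error, and the
  -- failure of each of the three deviation bounds.
  refine le_trans (measure_mono ?_) ((measure_union_le _ _).trans (add_le_add
    ((measure_union_le _ _).trans (add_le_add
      ((measure_union_le _ _).trans (add_le_add e₀ e₁)) e₂)) e₃) |>.trans (le_of_eq ?_))
  swap
  · rw [← ENNReal.ofReal_add (by positivity) (by positivity),
      ← ENNReal.ofReal_add (by positivity) (by positivity),
      ← ENNReal.ofReal_add (by positivity) (by positivity)]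
    congr 1
    ring
  intro ω hω
  by_contra hgood
  simp only [Set.mem_union, Set.mem_ofPred_eq, not_or, not_not, not_lt] at hgood
  obtain ⟨⟨⟨g₀, g₁⟩, g₂⟩, g₃⟩ := hgood
  refine hω ?_
  set u : Fin p → ℝ := (δ k)⁻¹ • (β₀ k ω - βs).ofLp with hu_def
  have hβ : β₀ k ω = βs + δ k • WithLp.toLp 2 u := by
    rw [hu_def, WithLp.toLp_smul, smul_inv_smul₀ hδk.ne']
    simp
  have hu : ‖u‖ ≤ M := by
    refine (pi_norm_le_iff_of_nonneg hM.le).2 fun j => ?_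
    have h1 : |(β₀ k ω - βs) j| ≤ ‖β₀ k ω - βs‖ := PiLp.norm_apply_le (β₀ k ω - βs) j
    rw [abs_norm] at g₀
    have h2 : M' * δ k ≤ M * δ k := mul_le_mul_of_nonneg_right (le_max_left _ _) hδk.le
    rw [hu_def, Pi.smul_apply, smul_eq_mul, norm_mul, Real.norm_eq_abs, Real.norm_eq_abs,
      abs_of_pos (inv_pos.2 hδk), inv_mul_le_iff₀ hδk]
    linarith
  rw [hβ]
  have hcard : (Fintype.card (Fin (L k) × Fin (m k)) : ℝ) = ((L k * m k : ℕ) : ℝ) := by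
    rw [card_prod_fin]
  have hhessian : ∀ i j, |avgHess H (h k) (fun l j => observe βs (W k l j ω))
      (βs + δ k • WithLp.toLp 2 u) i j - popHess P ρ i j| < e := fun i j => by
    have h1 := g₁ (i, j) u hu
    have h2 := abs_integral_hessTerm_sub_le (i := i) (j := j) hH hB hF_reg hρ hC hη hloc hb hb0
      hhk hkη' (a := fun z => δ k * dot z u) (by fun_prop) (hdot u hu)
    rw [avgHess_eq (h k) (δ k) (fun l j => W k l j ω) u i j]
    rw [empDev, hcard] at h1
    refine lt_of_le_of_lt ((abs_sub_le _ _ _).trans (add_le_add h1 h2)) hk_hess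
  obtain ⟨hunit, hinv⟩ := hclose _ hhessian
  refine ⟨hunit, ?_⟩
  rw [newtonStep_sub (δ k) _ u hunit]
  refine (norm_toLp_le (c := p * (K * (A₄ * R))) (by positivity)
    (abs_mulVec_le hK hinv fun i => ?_)).trans (le_of_eq (by ring))
  rw [Pi.sub_apply, avgHess_mulVec_sub_avgGrad (δ k) (fun l j => W k l j ω) u i]
  have h1 := g₂ i u hu
  have h2 := g₃ i
  have h3 := abs_integral_newtonTerm_le (i := i) hH hB hF_reg hρ hC hloc hb hb0
    hhk hkη' (a := fun z => δ k * dot z u) (by fun_prop) (hdot u hu)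
  have hi0 : Integrable (fun w => newtonTerm βs H (h k) i w 0) P :=
    integrable_of_ae_abs_le (by fun_prop)
      (hb.mono fun w hw => abs_newtonTerm_zero_le hB hhk hw)
  have hiu : Integrable (fun w => newtonTerm βs H (h k) i w (δ k * dot (covZ w) u)) P := by
    have hcb := hcl₂ _ _ hhk hk1 hδk hkδ hkη i
    have h5 := (integrable_of_ae_abs_le (hcb.measurable u)
      (hcb.envelope.mono fun w hw => hw u hu)).const_mul (δ k)
    refine (h5.add hi0).congr (Eventually.of_forall fun w => ?_)
    simp only [Pi.add_apply, mul_inv_cancel_left₀ hδk.ne']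
    ring
  rw [empDev_const_mul, empDev_sub _ hiu hi0, abs_mul, abs_of_pos (inv_pos.2 hδk),
    inv_mul_le_iff₀ hδk] at h1
  set E := empDev P (fun q : Fin (L k) × Fin (m k) => W k q.1 q.2)
    (fun w => newtonTerm βs H (h k) i w (δ k * dot (covZ w) u)) ω with hE
  set E₀ := empDev P (fun q : Fin (L k) × Fin (m k) => W k q.1 q.2)
    (fun w => newtonTerm βs H (h k) i w 0) ω with hE₀
  set I := ∫ w, newtonTerm βs H (h k) i w (δ k * dot (covZ w) u) ∂P with hI
  -- Empirical mean = (deviation at `u` minus deviation at `0`) + deviation at `0` + mean.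
  have hsum : ((L k * m k : ℕ) : ℝ)⁻¹ * ∑ q : Fin (L k) × Fin (m k),
      newtonTerm βs H (h k) i (W k q.1 q.2 ω) (δ k * dot (covZ (W k q.1 q.2 ω)) u)
      = (E - E₀) + E₀ + I := by
    rw [sub_add_cancel, hE, empDev, hcard, ← hI]
    ring
  rw [hsum]
  refine (abs_add_le _ _).trans ((add_le_add ((abs_add_le _ _).trans (add_le_add h1 h2)) h3).trans
    ?_)
  have t1 : 0 ≤ δ k * r k := by positivity
  have t2 : 0 ≤ √(1 / (((L k * m k : ℕ) : ℝ) * h k)) := Real.sqrt_nonneg _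
  have t3 : 0 ≤ δ k ^ 2 := sq_nonneg _
  have t4 : 0 ≤ h k ^ α := by positivity
  have s1 : δ k * (A₂ * r k) ≤ A₂ * R := by
    rw [mul_left_comm]
    exact mul_le_mul_of_nonneg_left (by linarith) hA₂
  have s2 : A₃ * √(1 / (((L k * m k : ℕ) : ℝ) * h k)) ≤ A₃ * R :=
    mul_le_mul_of_nonneg_left (by linarith) hA₃
  have s3 : (δ k * a) ^ 2 + h k ^ α ≤ (a ^ 2 + 1) * R := by
    have u1 : a ^ 2 * δ k ^ 2 ≤ a ^ 2 * R := mul_le_mul_of_nonneg_left (by linarith) (sq_nonneg a)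
    rw [mul_pow]
    linarith
  have s4 : b * (2 * B * C * ((δ k * a) ^ 2 + h k ^ α)) ≤ b * (2 * B * C * ((a ^ 2 + 1) * R)) := by
    gcongr
  rw [hA₄]
  linarith

end SMSE

theorem proposition1 {p : ℕ}
    -- the law `P` of `(X, Z, ε)`, the true parameter, the smoother, the conditional density
    (P : Measure (SMSE.Triple p)) [IsProbabilityMeasure P]
    (βs : SMSE.Vec p) (H : ℝ → ℝ) (α : ℕ) (ρ : SMSE.Vec p → ℝ → ℝ)
    (hmedian : SMSE.NoiseMedianZero P)
    (hH : SMSE.IsSmoother H α)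
    (hρ : SMSE.IsCondDensity P βs ρ)
    (hρ_reg : SMSE.IndexDensityRegular P ρ α)
    (hF_reg : SMSE.NoiseRegular P α)
    (hV : SMSE.PopHessNondegenerate P ρ)
    (hZ : SMSE.CovariatesBounded P)
    -- at stage `k`: `L k` machines with `m k` i.i.d. data points each, `n = L k * m k → ∞`
    {Ω : Type*} [MeasurableSpace Ω] (μ : Measure Ω) [IsProbabilityMeasure μ]
    (L m : ℕ → ℕ) (hn : Tendsto (fun k => L k * m k) atTop atTop)
    (W : ∀ k, Fin (L k) → Fin (m k) → Ω → SMSE.Triple p)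
    (hW_law : ∀ k l j, HasLaw (W k l j) P μ)
    (hW_indep : ∀ k, iIndepFun (fun i : Fin (L k) × Fin (m k) => W k i.1 i.2) μ)
    -- bandwidth, rate of the initial estimator, initial estimator
    (h δ : ℕ → ℝ) (hh_pos : ∀ k, 0 < h k) (hδ_pos : ∀ k, 0 < δ k)
    (β₀ : ℕ → Ω → SMSE.Vec p) (hβ₀_meas : ∀ k, AEMeasurable (β₀ k) μ)
    (hβ₀ : SMSE.IsBigOP μ (fun k ω => ‖β₀ k ω - βs‖) δ)
    (hδ : δ =O[atTop] h)
    (hh : Tendsto h atTop (𝓝 0))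
    (hnh : Tendsto (fun k => Real.log ((L k * m k : ℕ) : ℝ) / (((L k * m k : ℕ) : ℝ) * h k ^ 3))
      atTop (𝓝 0)) :
    -- the averaged Hessian is invertible with probability tending to one
    Tendsto
      (fun k => μ {ω | IsUnit
        (SMSE.avgHess H (h k) (fun l j => SMSE.observe βs (W k l j ω)) (β₀ k ω))})
      atTop (𝓝 1) ∧
    -- the error of the one-step estimator
    SMSE.IsBigOP μ
      (fun k ω =>
        ‖SMSE.newtonStep H (h k) (fun l j => SMSE.observe βs (W k l j ω)) (β₀ k ω) - βs‖)
      (fun k => δ k ^ 2 + h k ^ α + √(1 / (((L k * m k : ℕ) : ℝ) * h k))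
        + δ k * √(Real.log ((L k * m k : ℕ) : ℝ) / (((L k * m k : ℕ) : ℝ) * h k ^ 3))) := by
  have key := SMSE.exists_newton_bound P βs H α ρ hmedian hH hρ hρ_reg hF_reg hV hZ μ L m hn W
    hW_law hW_indep h δ hh_pos hδ_pos β₀ hβ₀ hδ hh hnh
  refine ⟨SMSE.tendsto_measure_of_compl_le fun ε hε => ?_, fun ε hε => ?_⟩
  · obtain ⟨A, hA⟩ := key ε hε
    filter_upwards [hA] with k hk
    refine (measure_mono fun ω hω => ?_).trans hk
    exact fun hgood => hω hgood.1
  · obtain ⟨A, hA⟩ := key ε hε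
    refine ⟨A, ?_⟩
    filter_upwards [hA] with k hk
    refine (measure_mono fun ω hω => ?_).trans hk
    intro hgood
    rw [Set.mem_ofPred_eq, abs_norm] at hω
    exact absurd hgood.2 (not_le.2 hω)
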